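/- A graphon is a measurable symmetric function $W:[0,1]^2\to[0,1]$; it defines the operator $(T_WX)(v)=\int_0^1 W(u,v)X(u)\,du$ on $L^2([0,1])$. Let $\lambda_1(W)\ge\lambda_2(W)\ge\dots\ge 0$ be the positive eigenvalues of $T_W$ and $\lambda_{-1}(W)\le\lambda_{-2}(W)\le\dots\le 0$ its negative eigenvalues, each repeated according to multiplicity and each list continued by zeros if it is finite. Call $W$ piecewise Lipschitz with $K$ intervals and constant $L$ if there are $0=\alpha_0\le\alpha_1\le\dots\le\alpha_K=1$ such that $|W(x,y)-W(x',y')|\le L(|x-x'|+|y-y'|)$ whenever $(x,y)$ and $(x',y')$ lie in the same rectangle $(\alpha_k,\alpha_{k+1})\times(\alpha_l,\alpha_{l+1})$, $0\le k,l<K$. Let $u_1,\dots,u_n$ be independent and uniform on $[0,1]$. A graph $G_n$ on $n$ nodes is sampled from $W$ either as the complete weighted graph in which the edge $\{i,j\}$ has weight $W(u_i,u_j)$, or as the stochastic unweighted graph in which, given $u_1,\dots,u_n$, each edge $\{i,j\}$ is present independently with probability $W(u_i,u_j)$; in both cases self-loops $i=j$ may either be excluded, or be included under the same rule. With $A$ its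 adjacency matrix and $I_j=[\frac{j-1}{n},\frac jn)$ for $j<n$, $I_n=[\frac{n-1}{n},1]$, the induced graphon is $W_{G_n}(u,v)=\sum_{j,k=1}^n A_{jk}\,\mathbb 1[u\in I_j]\,\mathbb 1[v\in I_k]$. **Proposition (piecewise-Lipschitz case).** For all $K\in\mathbb N$, $L\in\mathbb R$ and $a>0$ there is a constant $C=C(K,L,a)$ such that for every graphon $W$ that is piecewise Lipschitz with $K$ intervals and constant $L$, every $n\ge 2$, and $G_n$ sampled from $W$ in any of the ways above, with probability at least $1-n^{-a}$, $$|\lambda_i(W_{G_n})-\lambda_i(W)|\le C\left(\frac{\log n}{n}\right)^{1/4}\qquad\text{for all } i\in\mathbb Z\setminus\{0\}.$$ -/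

import Mathlib

open MeasureTheory

/-- A graphon: a measurable symmetric function `W : [0,1]² → [0,1]`. -/
structure Graphon where
  toFun : unitInterval → unitInterval → ℝ
  measurable_toFun : Measurable (Function.uncurry toFun)
  symm : ∀ u v, toFun u v = toFun v u
  mem_Icc : ∀ u v, toFun u v ∈ Set.Icc (0 : ℝ) 1

namespace Graphon

/-- `W` is piecewise Lipschitz with `K` intervals and constant `L`: there are breakpoints
`0 = α₀ ≤ α₁ ≤ ⋯ ≤ α_K = 1` such that `W` is `L`-Lipschitz (for the `ℓ¹` distance) on each of the
`K²` open rectangles `(α_k, α_{k+1}) × (α_l, α_{l+1})`. The values of `W` on the boundaries of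
the rectangles are unrestricted. -/
def IsPiecewiseLipschitz (W : Graphon) (K : ℕ) (L : ℝ) : Prop :=
  ∃ α : Fin (K + 1) → ℝ, Monotone α ∧ α 0 = 0 ∧ α (Fin.last K) = 1 ∧
    ∀ k l : Fin K, ∀ x y x' y' : unitInterval,
      (x : ℝ) ∈ Set.Ioo (α k.castSucc) (α k.succ) →
      (x' : ℝ) ∈ Set.Ioo (α k.castSucc) (α k.succ) →
      (y : ℝ) ∈ Set.Ioo (α l.castSucc) (α l.succ) →
      (y' : ℝ) ∈ Set.Ioo (α l.castSucc) (α l.succ) →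
      |W.toFun x y - W.toFun x' y'| ≤ L * (|(x : ℝ) - x'| + |(y : ℝ) - y'|)

/-- The function `v ↦ ∫₀¹ W(u, v) X(u) du`. -/
noncomputable def integralFun (W : Graphon) (X : unitInterval → ℝ) (v : unitInterval) : ℝ :=
  ∫ u, W.toFun u v * X u

theorem integrable_mul (W : Graphon) (X : Lp ℝ 2 (volume : Measure unitInterval))
    (v : unitInterval) : Integrable (fun u => W.toFun u v * X u) := by
  have hX : Integrable (fun u => X u) := (Lp.memLp X).integrable (by norm_num)
  refine hX.bdd_mul (c := 1) ?_ (Filter.Eventually.of_forall fun u => ?_)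
  · exact (W.measurable_toFun.comp (measurable_id.prodMk measurable_const)).aestronglyMeasurable
  · rw [Real.norm_eq_abs, abs_of_nonneg (W.mem_Icc u v).1]
    exact (W.mem_Icc u v).2

theorem abs_integralFun_le (W : Graphon) (X : Lp ℝ 2 (volume : Measure unitInterval))
    (v : unitInterval) : ‖W.integralFun X v‖ ≤ ‖X‖ := by
  have hX : Integrable (fun u => X u) := (Lp.memLp X).integrable (by norm_num)
  have h1 : ‖W.integralFun X v‖ ≤ ∫ u, ‖X u‖ := by
    refine norm_integral_le_of_norm_le hX.norm (Filter.Eventually.of_forall fun u => ?_)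
    rw [norm_mul, Real.norm_eq_abs (W.toFun u v), abs_of_nonneg (W.mem_Icc u v).1]
    exact mul_le_of_le_one_left (norm_nonneg _) (W.mem_Icc u v).2
  refine h1.trans ?_
  rw [integral_norm_eq_lintegral_enorm hX.aestronglyMeasurable, Lp.norm_def,
    ← eLpNorm_one_eq_lintegral_enorm]
  exact ENNReal.toReal_mono (Lp.eLpNorm_ne_top X)
    (eLpNorm_le_eLpNorm_of_exponent_le (by norm_num) (Lp.aestronglyMeasurable X))

theorem memLp_integralFun (W : Graphon) (X : Lp ℝ 2 (volume : Measure unitInterval)) :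
    MemLp (W.integralFun X) 2 volume := by
  refine MemLp.of_bound (StronglyMeasurable.aestronglyMeasurable ?_) ‖X‖
    (Filter.Eventually.of_forall (W.abs_integralFun_le X))
  exact StronglyMeasurable.integral_prod_left'
    (f := fun p : unitInterval × unitInterval => W.toFun p.1 p.2 * X p.1)
    (W.measurable_toFun.stronglyMeasurable.mul
      ((Lp.stronglyMeasurable X).comp_measurable measurable_fst))

/-- The graphon operator `T_W` on `L²([0,1])`, `(T_W X)(v) = ∫₀¹ W(u, v) X(u) du`. -/
noncomputable def operator (W : Graphon) :
    Lp ℝ 2 (volume : Measure unitInterval) →L[ℝ] Lp ℝ 2 (volume : Measure unitInterval) :=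
  LinearMap.mkContinuous
    { toFun := fun X => (W.memLp_integralFun X).toLp (W.integralFun X)
      map_add' := fun X Y => by
        rw [← MemLp.toLp_add]
        refine MemLp.toLp_congr _ _ (Filter.Eventually.of_forall fun v => ?_)
        rw [Pi.add_apply]
        unfold integralFun
        rw [← integral_add (W.integrable_mul X v) (W.integrable_mul Y v)]
        refine integral_congr_ae ?_
        filter_upwards [Lp.coeFn_add X Y] with u hu
        rw [hu, Pi.add_apply, mul_add]
      map_smul' := fun c X => by
        rw [RingHom.id_apply, ← MemLp.toLp_const_smul]
        refine MemLp.toLp_congr _ _ (Filter.Eventually.of_forall fun v => ?_)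
        rw [Pi.smul_apply, smul_eq_mul]
        unfold integralFun
        rw [← integral_const_mul]
        refine integral_congr_ae ?_
        filter_upwards [Lp.coeFn_smul c X] with u hu
        rw [hu, Pi.smul_apply, smul_eq_mul]
        ring }
    1 fun X => by
      have h := Lp.norm_le_of_ae_bound (f := (W.memLp_integralFun X).toLp (W.integralFun X))
        (norm_nonneg X) (by
          filter_upwards [(W.memLp_integralFun X).coeFn_toLp] with v hv
          rw [hv]
          exact W.abs_integralFun_le X v)
      have h1 : measureUnivNNReal (volume : Measure unitInterval) = 1 := by
        simp [measureUnivNNReal]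
      rw [h1] at h
      simpa using h

/-- The eigenvalues `λ_i(W)` of `T_W`, `i ∈ ℤ ∖ {0}`, counted with multiplicity:
`λ₁ ≥ λ₂ ≥ ⋯ ≥ 0 ≥ ⋯ ≥ λ₋₂ ≥ λ₋₁`. For `i > 0` this is the `i`-th largest positive eigenvalue,
and for `i < 0` the `|i|`-th smallest negative eigenvalue; it is `0` if there are fewer than `|i|`
eigenvalues of that sign (`sSup ∅ = sInf ∅ = 0`). The value at `i = 0` has no meaning.
In terms of multiplicities, `λ_i` with `i > 0` is the largest `t > 0` such that the
eigenspaces for eigenvalues `μ ≥ t` together have dimension at least `i`. -/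
noncomputable def eigenvalue (W : Graphon) (i : ℤ) : ℝ :=
  if 0 < i then
    sSup {t : ℝ | 0 < t ∧ (i.natAbs : Cardinal) ≤
      Module.rank ℝ ↥(⨆ (μ : ℝ) (_ : t ≤ μ),
        Module.End.eigenspace W.operator.toLinearMap μ)}
  else
    sInf {t : ℝ | t < 0 ∧ (i.natAbs : Cardinal) ≤
      Module.rank ℝ ↥(⨆ (μ : ℝ) (_ : μ ≤ t),
        Module.End.eigenspace W.operator.toLinearMap μ)}

end Graphon

/-- An undirected graph with nodes `0, …, n - 1` and edge weights in `[0,1]`, given by its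
adjacency matrix. -/
structure WeightedGraph (n : ℕ) where
  adj : Matrix (Fin n) (Fin n) ℝ
  symm : ∀ i j, adj i j = adj j i
  mem_Icc : ∀ i j, adj i j ∈ Set.Icc (0 : ℝ) 1

/-- The `j`-th interval of the regular partition of `[0,1]`, `j = 0, …, n - 1`:
`[j/n, (j+1)/n)`, and `[(n-1)/n, 1]` for `j = n - 1`. -/
def regularInterval (n : ℕ) (j : Fin n) : Set unitInterval :=
  {u | (j : ℝ) / n ≤ u ∧ ((u : ℝ) < ((j : ℝ) + 1) / n ∨ (j : ℕ) + 1 = n)}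

theorem measurableSet_regularInterval (n : ℕ) (j : Fin n) :
    MeasurableSet (regularInterval n j) := by
  refine (measurableSet_le measurable_const measurable_subtype_coe).inter
    ((measurableSet_lt measurable_subtype_coe measurable_const).union ?_)
  exact MeasurableSet.const _

theorem regularInterval_eq {n : ℕ} {j k : Fin n} {u : unitInterval}
    (hj : u ∈ regularInterval n j) (hk : u ∈ regularInterval n k) : j = k := by
  have key : ∀ j k : Fin n, u ∈ regularInterval n j → u ∈ regularInterval n k →
      (k : ℕ) ≤ j := by
    intro j k hj hk
    have hn : (0 : ℝ) < n := by exact_mod_cast j.pos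
    rcases hj.2 with h | h
    · have h1 := lt_of_le_of_lt hk.1 h
      rw [div_lt_div_iff_of_pos_right hn] at h1
      have h2 : (k : ℕ) < (j : ℕ) + 1 := by exact_mod_cast h1
      omega
    · have := k.isLt
      omega
  exact Fin.ext (le_antisymm (key k j hk hj) (key j k hj hk))

/-- The graphon `W_G(u, v) = ∑_j ∑_k A_{jk} 1[u ∈ I_j] 1[v ∈ I_k]` induced by a graph. -/
noncomputable def WeightedGraph.inducedGraphon {n : ℕ} (G : WeightedGraph n) : Graphon where
  toFun u v := ∑ j, ∑ k, G.adj j k *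
    (regularInterval n j).indicator 1 u * (regularInterval n k).indicator 1 v
  measurable_toFun := by
    refine Finset.measurable_fun_sum _ fun j _ => Finset.measurable_fun_sum _ fun k _ => ?_
    refine (measurable_const.mul ?_).mul ?_
    · exact (measurable_one.indicator (measurableSet_regularInterval n j)).comp measurable_fst
    · exact (measurable_one.indicator (measurableSet_regularInterval n k)).comp measurable_snd
  symm u v := by
    rw [Finset.sum_comm]
    refine Finset.sum_congr rfl fun j _ => Finset.sum_congr rfl fun k _ => ?_
    rw [G.symm k j]
    ring
  mem_Icc u v := by
    by_cases hu : ∃ j, u ∈ regularInterval n j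
    · obtain ⟨j, hj⟩ := hu
      by_cases hv : ∃ k, v ∈ regularInterval n k
      · obtain ⟨k, hk⟩ := hv
        rw [Finset.sum_eq_single j, Finset.sum_eq_single k]
        · simpa [hj, hk] using G.mem_Icc j k
        · intro k' _ hne
          rw [Set.indicator_of_notMem (fun h => hne (regularInterval_eq h hk)), mul_zero]
        · simp
        · intro j' _ hne
          refine Finset.sum_eq_zero fun k' _ => ?_
          rw [Set.indicator_of_notMem (fun h => hne (regularInterval_eq h hj)), mul_zero, zero_mul]
        · simp
      · rw [Finset.sum_eq_zero]
        · simp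
        · intro j' _
          refine Finset.sum_eq_zero fun k' _ => ?_
          rw [Set.indicator_of_notMem (fun h => hv ⟨_, h⟩), mul_zero]
    · rw [Finset.sum_eq_zero]
      · simp
      · intro j' _
        refine Finset.sum_eq_zero fun k' _ => ?_
        rw [Set.indicator_of_notMem (fun h => hu ⟨_, h⟩), mul_zero, zero_mul]

/-- The complete weighted graph sampled from `W` at the points `u`: the edge `{i, j}` has weight
`W(u_i, u_j)`. With `loops = false` only edges with `i ≠ j` are present (zero diagonal); with
`loops = true` the rule applies to `i = j` as well. -/
noncomputable def Graphon.weightedSample (W : Graphon) {n : ℕ} (loops : Bool)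
    (u : Fin n → unitInterval) : WeightedGraph n where
  adj i j := if i = j ∧ loops = false then 0 else W.toFun (u i) (u j)
  symm i j := by
    rw [W.symm (u i) (u j)]
    simp only [eq_comm]
  mem_Icc i j := by
    split_ifs
    · simp
    · exact W.mem_Icc _ _

open Classical in
/-- The stochastic unweighted graph sampled from `W` at the points `u`: the edge `{i, j}` is
present when `ξ_{ij} < W(u_i, u_j)`. When the `ξ_e` are independent and uniform on `[0,1]`, and
independent of `u`, this means that, given `u`, the edges are independent and `{i, j}` is present
with probability `W(u_i, u_j)`. The role of `loops` is as in `Graphon.weightedSample`. -/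
noncomputable def Graphon.stochasticSample (W : Graphon) {n : ℕ} (loops : Bool)
    (u : Fin n → unitInterval) (ξ : Sym2 (Fin n) → unitInterval) : WeightedGraph n where
  adj i j := if i = j ∧ loops = false then 0 else
    if (ξ s(i, j) : ℝ) < W.toFun (u i) (u j) then 1 else 0
  symm i j := by
    rw [W.symm (u i) (u j), Sym2.eq_swap]
    simp only [eq_comm]
  mem_Icc i j := by
    split_ifs <;> simp

/-!
The eigenvalues of compact self-adjoint operators are 1-Lipschitz in the operator norm (Weyl). The
version `posEigenvalue_le_add` used here compares two quadratic forms through a linear contraction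
`J` instead of the identity; it follows from the Courant–Fischer principle
`rank_le_rank_iSup_eigenspace`. The contraction that permutes the normalized indicators of the
intervals of the regular partition shows that the eigenvalues of an induced graphon do not depend
on the labelling of the nodes, and that they move by at most `‖A - A'‖ / n` when the adjacency
matrix `A` is replaced by `A'`. Negative eigenvalues are the positive ones of `-T_W`.

*Weighted sample.* By relabelling, the sample points may be assumed sorted. By Hoeffding's
inequality the numbers of points in the intervals `[0, k / n]` are all within `O(√(n log n))` of
`k`, with the required probability, so that the `j`-th point is within
`r = O(√(log n / n))` of the `j`-th interval (`abs_sort_sub_le`). The induced graphon then differs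
from `W` by at most `2 |L| r`, except where a coordinate is within `r` of a breakpoint or on the
diagonal blocks, a set of measure `O(r + 1 / n)` on which the difference is at most `1`. The squared
Hilbert–Schmidt distance is therefore `O(√(log n / n))`, which gives the exponent `1 / 4`
(`Graphon.integral_sq_weightedSample_sub_le`). The same estimate with the points `j / n` exhibits
`T_W` as a norm limit of finite-rank operators, hence as a compact operator.

*Stochastic sample.* Given the points, the noise matrix `M = A - E A` is symmetric with independent
centred entries. For `i ≠ j` the products `M_ik M_kj`, `k ∉ {i, j}`, involve disjoint sets of edges,
so by Hoeffding's inequality all off-diagonal entries of `M²` are `O(√(n log n))`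
(`Graphon.hasSubgaussianMGF_noiseSq`). As the diagonal entries are at most `n`, this yields
`‖M‖² = ‖M²‖ = O(n √(n log n))` (`abs_quadratic_form_le`), and `‖M‖ / n = O((log n / n) ^ (1 / 4))`.
-/

/-! ### Positive eigenvalues of compact self-adjoint operators -/

section Abstract

open Module End

variable {H : Type*} [NormedAddCommGroup H] [InnerProductSpace ℝ H]

/-- The `m`-th largest positive eigenvalue of `T`, counted with multiplicity, and `0` if `T` has
fewer than `m` positive eigenvalues: the largest `t > 0` such that the eigenspaces for eigenvalues
`μ ≥ t` together have dimension at least `m`. -/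
noncomputable def posEigenvalue (T : H →L[ℝ] H) (m : ℕ) : ℝ :=
  sSup {t : ℝ | 0 < t ∧ (m : Cardinal) ≤
    Module.rank ℝ ↥(⨆ (μ : ℝ) (_ : t ≤ μ), eigenspace T.toLinearMap μ)}

/-- A vector in a sum of eigenspaces splits into finitely many orthogonal eigenvectors, which
diagonalizes its norm and its quadratic form simultaneously. -/
theorem exists_orthogonal_sum_eigenvectors {T : H →L[ℝ] H}
    (hT : T.toLinearMap.IsSymmetric) {p : ℝ → Prop} {x : H}
    (hx : x ∈ ⨆ (μ : ℝ) (_ : p μ), eigenspace T.toLinearMap μ) :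
    ∃ (s : Finset ℝ) (f : ℝ → H), (∀ μ ∈ s, p μ) ∧ inner ℝ (T x) x = ∑ μ ∈ s, μ * ‖f μ‖ ^ 2 ∧
      ‖x‖ ^ 2 = ∑ μ ∈ s, ‖f μ‖ ^ 2 := by
  classical
  obtain ⟨f, hf, rfl⟩ := (Submodule.mem_iSup_iff_exists_finsupp _ _).1 hx
  have hfE : ∀ μ, T (f μ) = μ • f μ := by
    intro μ
    have := hf μ
    by_cases h : p μ
    · simp only [h, iSup_pos] at this
      exact mem_eigenspace_iff.1 this
    · simp only [h, iSup_neg, Submodule.mem_bot, not_false_eq_true] at this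
      simp [this]
  have hort : ∀ μ ν, μ ≠ ν → inner ℝ (f μ) (f ν) = 0 := by
    intro μ ν h
    exact hT.orthogonalFamily_eigenspaces h ⟨f μ, mem_eigenspace_iff.2 (hfE μ)⟩
      ⟨f ν, mem_eigenspace_iff.2 (hfE ν)⟩
  refine ⟨f.support, f, ?_, ?_, ?_⟩
  · intro μ hμ
    by_contra h
    have := hf μ
    simp only [h, iSup_neg, Submodule.mem_bot, not_false_eq_true] at this
    exact (Finsupp.mem_support_iff.1 hμ) this
  · simp only [Finsupp.sum, map_sum, sum_inner, inner_sum]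
    refine Finset.sum_congr rfl fun μ hμ => ?_
    rw [Finset.sum_eq_single μ]
    · rw [hfE, inner_smul_left, real_inner_self_eq_norm_sq]; rfl
    · intro ν _ h
      rw [hfE, inner_smul_left, hort _ _ h, mul_zero]
    · exact fun h => absurd hμ h
  · simp only [Finsupp.sum]
    rw [← real_inner_self_eq_norm_sq]
    simp only [sum_inner, inner_sum]
    refine Finset.sum_congr rfl fun μ hμ => ?_
    rw [Finset.sum_eq_single μ]
    · rw [real_inner_self_eq_norm_sq]
    · intro ν _ h
      rw [hort _ _ h]
    · exact fun h => absurd hμ h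

theorem mul_norm_sq_le_inner_of_mem_iSup_eigenspace {T : H →L[ℝ] H}
    (hT : T.toLinearMap.IsSymmetric) {t : ℝ} {x : H}
    (hx : x ∈ ⨆ (μ : ℝ) (_ : t ≤ μ), eigenspace T.toLinearMap μ) :
    t * ‖x‖ ^ 2 ≤ inner ℝ (T x) x := by
  obtain ⟨s, f, hp, h1, h2⟩ := exists_orthogonal_sum_eigenvectors hT hx
  rw [h1, h2, Finset.mul_sum]
  gcongr with μ hμ
  exact hp μ hμ

theorem inner_le_mul_norm_sq_of_mem_closure_iSup_eigenspace {T : H →L[ℝ] H}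
    (hT : T.toLinearMap.IsSymmetric) {t : ℝ} {x : H}
    (hx : x ∈ (⨆ (μ : ℝ) (_ : μ < t), eigenspace T.toLinearMap μ).topologicalClosure) :
    inner ℝ (T x) x ≤ t * ‖x‖ ^ 2 := by
  have hcl : IsClosed {x : H | inner ℝ (T x) x ≤ t * ‖x‖ ^ 2} :=
    isClosed_le (by fun_prop) (by fun_prop)
  refine closure_minimal (s := ((⨆ (μ : ℝ) (_ : μ < t), eigenspace T.toLinearMap μ :
    Submodule ℝ H) : Set H)) (fun y hy => ?_) hcl hx
  obtain ⟨s, f, hp, h1, h2⟩ := exists_orthogonal_sum_eigenvectors hT hy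
  rw [Set.mem_ofPred_eq, h1, h2, Finset.mul_sum]
  gcongr with μ hμ
  exact (hp μ hμ).le

/-- Courant–Fischer: a subspace on which the quadratic form of a compact self-adjoint operator is
at least `s` has at most the dimension of the sum of the eigenspaces for eigenvalues `≥ t`, for
each `t < s`. Otherwise it would meet the orthogonal complement of that sum, where the quadratic
form is at most `t` by the spectral theorem. -/
theorem rank_le_rank_iSup_eigenspace [CompleteSpace H] {T : H →L[ℝ] H}
    (hT : T.toLinearMap.IsSymmetric) (hc : IsCompactOperator T) {s t : ℝ} (hts : t < s)
    {V : Submodule ℝ H} {m : ℕ} (hV : (m : Cardinal) ≤ Module.rank ℝ V)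
    (hVs : ∀ x ∈ V, s * ‖x‖ ^ 2 ≤ inner ℝ (T x) x) :
    (m : Cardinal) ≤ Module.rank ℝ ↥(⨆ (μ : ℝ) (_ : t ≤ μ), eigenspace T.toLinearMap μ) := by
  set U : Submodule ℝ H := ⨆ (μ : ℝ) (_ : t ≤ μ), eigenspace T.toLinearMap μ with hU
  set U' : Submodule ℝ H := ⨆ (μ : ℝ) (_ : μ < t), eigenspace T.toLinearMap μ with hU'
  by_contra! hlt
  have hfin : FiniteDimensional ℝ U := by
    exact Module.rank_lt_aleph0_iff.1 (hlt.trans Cardinal.natCast_lt_aleph0)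
  have hUU' : U ⟂ U' := by
    rw [Submodule.isOrtho_iSup_left]
    intro μ
    rw [Submodule.isOrtho_iSup_left]
    intro hμ
    rw [Submodule.isOrtho_iSup_right]
    intro ν
    rw [Submodule.isOrtho_iSup_right]
    intro hν
    exact hT.orthogonalFamily_eigenspaces.isOrtho (ne_of_gt (hν.trans_le hμ))
  -- the spectral theorem: nothing is orthogonal to all eigenvectors
  have hbot : (U ⊔ U')ᗮ = ⊥ := by
    rw [← ContinuousLinearMap.orthogonalComplement_iSup_eigenspaces_eq_bot hc hT]
    congr 1
    refine le_antisymm (sup_le ?_ ?_) (iSup_le fun μ => ?_)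
    · exact iSup_mono fun μ => iSup_le fun _ => le_rfl
    · exact iSup_mono fun μ => iSup_le fun _ => le_rfl
    · rcases le_or_gt t μ with h | h
      · exact le_sup_of_le_left (le_iSup₂_of_le μ h le_rfl)
      · exact le_sup_of_le_right (le_iSup₂_of_le μ h le_rfl)
  -- a nonzero `x ∈ V ∩ Uᗮ`, as the projection of `V` to `U` cannot be injective
  let φ : V →ₗ[ℝ] U := (U.orthogonalProjectionOnto : H →ₗ[ℝ] U).comp V.subtype
  by_cases hinj : Function.Injective φ
  · exact absurd (hV.trans (LinearMap.rank_le_of_injective φ hinj)) (not_le.2 hlt)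
  rw [← LinearMap.ker_eq_bot, Submodule.eq_bot_iff] at hinj
  push Not at hinj
  obtain ⟨⟨x, hxV⟩, hx0, hxne⟩ := hinj
  have hxU : x ∈ Uᗮ := by
    have h : U.orthogonalProjectionOnto x = 0 := hx0
    rwa [Submodule.orthogonalProjectionOnto_eq_zero_iff] at h
  have hxne' : x ≠ 0 := fun h => hxne (Subtype.ext h)
  -- the component of `x` orthogonal to `U'` is orthogonal to all eigenvectors, hence zero
  have hxcl : x ∈ U'.topologicalClosure := by
    have : CompleteSpace U'.topologicalClosure :=
      U'.isClosed_topologicalClosure.completeSpace_coe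
    set q := U'.topologicalClosure.starProjection x with hq
    have hqm : q ∈ U'.topologicalClosure := by simp [hq]
    have hd : x - q ∈ U'ᗮ := by
      have := U'.topologicalClosure.sub_starProjection_mem_orthogonal x
      rwa [Submodule.orthogonal_closure] at this
    have hqU : q ∈ Uᗮ := by
      have h1 : U' ≤ Uᗮ := hUU'.symm
      exact U'.topologicalClosure_minimal h1 U.isClosed_orthogonal hqm
    have : x - q ∈ (U ⊔ U')ᗮ := by
      rw [← Submodule.inf_orthogonal]
      exact ⟨Uᗮ.sub_mem hxU hqU, hd⟩
    rw [hbot, Submodule.mem_bot, sub_eq_zero] at this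
    rw [this]; exact hqm
  have h1 := inner_le_mul_norm_sq_of_mem_closure_iSup_eigenspace hT hxcl
  have h2 := hVs x hxV
  have h3 : 0 < ‖x‖ ^ 2 := by positivity
  nlinarith

theorem posEigenvalue_nonneg (T : H →L[ℝ] H) (m : ℕ) : 0 ≤ posEigenvalue T m :=
  Real.sSup_nonneg fun _ ht => ht.1.le

theorem bddAbove_posEigenvalue_set (T : H →L[ℝ] H) {m : ℕ} (hm : m ≠ 0) :
    BddAbove {t : ℝ | 0 < t ∧ (m : Cardinal) ≤
      Module.rank ℝ ↥(⨆ (μ : ℝ) (_ : t ≤ μ), eigenspace T.toLinearMap μ)} := by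
  refine ⟨‖T‖, fun t ht => ?_⟩
  by_contra! hlt
  have hbot : (⨆ (μ : ℝ) (_ : t ≤ μ), eigenspace T.toLinearMap μ) = ⊥ := by
    simp only [iSup_eq_bot]
    intro μ hμ
    rw [Submodule.eq_bot_iff]
    intro x hx
    have hx' : T x = μ • x := mem_eigenspace_iff.1 hx
    have h1 := T.le_opNorm x
    rw [hx', norm_smul, Real.norm_eq_abs] at h1
    by_contra hne
    have h2 : 0 < ‖x‖ := norm_pos_iff.2 hne
    have := le_of_mul_le_mul_right h1 h2
    linarith [le_abs_self μ]
  have h := ht.2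
  rw [hbot, rank_bot] at h
  simp [hm] at h

/-- Weyl's inequality up to a contraction: if the contraction `J` carries the quadratic form
of `S` to that of `T` up to a loss of `δ`, the positive eigenvalues of `T` are at least those of
`S` minus `δ`. Since the form of `T` is positive on the image of the relevant eigenspaces, `J` is
automatically injective there. -/
theorem posEigenvalue_le_add [CompleteSpace H] {S T : H →L[ℝ] H}
    (hS : S.toLinearMap.IsSymmetric) (hT : T.toLinearMap.IsSymmetric) (hc : IsCompactOperator T)
    (J : H →ₗ[ℝ] H) (hJ : ∀ x, ‖J x‖ ≤ ‖x‖) {δ : ℝ} (hδ : 0 ≤ δ)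
    (h : ∀ x, inner ℝ (S x) x - δ * ‖x‖ ^ 2 ≤ inner ℝ (T (J x)) (J x)) {m : ℕ} (hm : m ≠ 0) :
    posEigenvalue S m ≤ posEigenvalue T m + δ := by
  refine Real.sSup_le (fun t ht => ?_) (add_nonneg (posEigenvalue_nonneg T m) hδ)
  rw [← sub_le_iff_le_add]
  rcases le_or_gt (t - δ) 0 with h0 | h0
  · exact h0.trans (posEigenvalue_nonneg T m)
  -- Courant–Fischer loses an arbitrarily small amount, so argue below `t - δ`
  refine le_of_forall_lt_imp_le_of_dense fun s hs => ?_
  rcases le_or_gt s 0 with hs0 | hs0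
  · exact hs0.trans (posEigenvalue_nonneg T m)
  refine le_csSup (bddAbove_posEigenvalue_set T hm) ⟨hs0, ?_⟩
  set V : Submodule ℝ H := ⨆ (μ : ℝ) (_ : t ≤ μ), eigenspace S.toLinearMap μ with hVdef
  have key : ∀ x ∈ V, (t - δ) * ‖x‖ ^ 2 ≤ inner ℝ (T (J x)) (J x) := by
    intro x hx
    have := mul_norm_sq_le_inner_of_mem_iSup_eigenspace hS hx
    linarith [h x]
  have hinj : Function.Injective (J.comp V.subtype) := by
    rw [← LinearMap.ker_eq_bot, Submodule.eq_bot_iff]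
    rintro ⟨x, hx⟩ h0x
    have h0x' : J x = 0 := h0x
    have h1 := key x hx
    rw [h0x', map_zero, inner_zero_left] at h1
    have h2 : ‖x‖ ^ 2 ≤ 0 := by nlinarith
    have : x = 0 := by
      rw [← norm_eq_zero]; exact pow_eq_zero_iff two_ne_zero |>.1 (le_antisymm h2 (by positivity))
    exact Subtype.ext this
  refine rank_le_rank_iSup_eigenspace hT hc hs (V := V.map J) (m := m) ?_ ?_
  · have e : V.map J = LinearMap.range (J.comp V.subtype) := by
      rw [LinearMap.range_comp, Submodule.range_subtype]
    rw [e, ← (LinearEquiv.ofInjective _ hinj).rank_eq]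
    exact ht.2
  · rintro _ ⟨x, hx, rfl⟩
    refine le_trans ?_ (key x hx)
    have := hJ x
    gcongr

theorem eigenspace_neg (T : H →L[ℝ] H) (μ : ℝ) :
    eigenspace (-T).toLinearMap μ = eigenspace T.toLinearMap (-μ) := by
  ext x
  simp only [mem_eigenspace_iff, ContinuousLinearMap.coe_coe, neg_apply,
    neg_smul]
  exact neg_eq_iff_eq_neg

end Abstract

namespace Graphon

open Module End

/-- Together with `eigenvalue_of_neg`: the eigenvalues of either sign are the positive eigenvalues
of `T_W` or of `-T_W`. -/
theorem eigenvalue_of_pos (W : Graphon) {i : ℤ} (hi : 0 < i) :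
    W.eigenvalue i = posEigenvalue W.operator i.natAbs :=
  if_pos hi

theorem eigenvalue_of_neg (W : Graphon) {i : ℤ} (hi : i < 0) :
    W.eigenvalue i = -posEigenvalue (-W.operator) i.natAbs := by
  rw [eigenvalue, if_neg hi.not_gt, Real.sInf_def, posEigenvalue]
  congr 2
  ext t
  simp only [Set.mem_neg, Set.mem_ofPred_eq, Left.neg_neg_iff]
  have : (⨆ (μ : ℝ) (_ : μ ≤ -t), eigenspace W.operator.toLinearMap μ) =
      ⨆ (μ : ℝ) (_ : t ≤ μ), eigenspace W.operator.toLinearMap (-μ) := by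
    refine le_antisymm (iSup₂_le fun μ hμ => ?_) (iSup₂_le fun μ hμ => ?_)
    · exact le_iSup₂_of_le (-μ) (by linarith) (by rw [neg_neg])
    · exact le_iSup₂_of_le (-μ) (by linarith) le_rfl
  have h2 : (⨆ (μ : ℝ) (_ : t ≤ μ), eigenspace (-W.operator).toLinearMap μ) =
      ⨆ (μ : ℝ) (_ : t ≤ μ), eigenspace W.operator.toLinearMap (-μ) :=
    iSup_congr fun μ => iSup_congr fun _ => eigenspace_neg _ μ
  rw [this, h2]

end Graphon

/-! ### Graphon operators on `L²` -/

theorem norm_sq_eq_integral_sq (x : Lp ℝ 2 (volume : Measure unitInterval)) :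
    ‖x‖ ^ 2 = ∫ u, x u ^ 2 := by
  rw [← real_inner_self_eq_norm_sq, L2.inner_def]
  simp [pow_two]

namespace Graphon

theorem operator_coeFn (W : Graphon) (X : Lp ℝ 2 (volume : Measure unitInterval)) :
    W.operator X =ᵐ[volume] W.integralFun X :=
  (W.memLp_integralFun X).coeFn_toLp

theorem inner_operator (W : Graphon) (x y : Lp ℝ 2 (volume : Measure unitInterval)) :
    inner ℝ (W.operator x) y = ∫ v, ∫ u, W.toFun u v * x u * y v := by
  rw [L2.inner_def]
  refine integral_congr_ae ?_
  filter_upwards [W.operator_coeFn x] with v hv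
  rw [hv, integral_mul_const, integralFun]
  simp [mul_comm]

theorem integrable_kernel_mul_mul (W : Graphon) (x y : Lp ℝ 2 (volume : Measure unitInterval)) :
    Integrable (fun p : unitInterval × unitInterval => W.toFun p.1 p.2 * x p.1 * y p.2)
      (volume.prod volume) := by
  have hx : Integrable (fun u => x u) := (Lp.memLp x).integrable (by norm_num)
  have hy : Integrable (fun u => y u) := (Lp.memLp y).integrable (by norm_num)
  have := (hx.mul_prod hy).bdd_mul (c := 1) (f := Function.uncurry W.toFun)
    W.measurable_toFun.aestronglyMeasurable (Filter.Eventually.of_forall fun p => by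
      rw [Function.uncurry_def, Real.norm_eq_abs, abs_of_nonneg (W.mem_Icc _ _).1]
      exact (W.mem_Icc _ _).2)
  simpa only [mul_assoc, Function.uncurry_def] using this

theorem isSymmetric_operator (W : Graphon) : W.operator.toLinearMap.IsSymmetric := by
  intro x y
  change inner ℝ (W.operator x) y = inner ℝ x (W.operator y)
  rw [real_inner_comm (W.operator y), inner_operator, inner_operator,
    integral_integral_swap (f := fun u v => W.toFun v u * y v * x u)]
  · refine integral_congr_ae (.of_forall fun v => integral_congr_ae (.of_forall fun u => ?_))
    simp only
    rw [W.symm u v]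
    ring
  · exact (W.integrable_kernel_mul_mul y x).swap

/-- The operator norm of a difference of graphon operators is at most its Hilbert–Schmidt norm. -/
theorem norm_operator_sub_le (W W' : Graphon) {δ : ℝ} (hδ : 0 ≤ δ)
    (h : ∫ v, ∫ u, (W.toFun u v - W'.toFun u v) ^ 2 ≤ δ ^ 2) :
    ‖W.operator - W'.operator‖ ≤ δ := by
  refine ContinuousLinearMap.opNorm_le_bound _ hδ fun x => ?_
  refine le_of_sq_le_sq ?_ (by positivity)
  have hD : Measurable fun p : unitInterval × unitInterval => W.toFun p.1 p.2 - W'.toFun p.1 p.2 :=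
    W.measurable_toFun.sub W'.measurable_toFun
  have hDle : ∀ u v, |W.toFun u v - W'.toFun u v| ≤ 1 := fun u v => by
    have h1 := W.mem_Icc u v
    have h2 := W'.mem_Icc u v
    rw [abs_le]
    constructor <;> linarith [h1.1, h1.2, h2.1, h2.2]
  have hDle2 : ∀ u v, ‖(W.toFun u v - W'.toFun u v) ^ 2‖ ≤ 1 := fun u v => by
    rw [Real.norm_eq_abs, abs_pow]
    exact pow_le_one₀ (abs_nonneg _) (hDle u v)
  have hDv : ∀ v, MemLp (fun u => W.toFun u v - W'.toFun u v) 2 volume := fun v =>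
    MemLp.of_bound (hD.comp (measurable_id.prodMk measurable_const)).aestronglyMeasurable 1
      (.of_forall fun u => hDle u v)
  -- Cauchy–Schwarz in the inner variable
  have hpt : ∀ v, (W.integralFun x v - W'.integralFun x v) ^ 2 ≤
      (∫ u, (W.toFun u v - W'.toFun u v) ^ 2) * ‖x‖ ^ 2 := by
    intro v
    have h1 : W.integralFun x v - W'.integralFun x v = inner ℝ ((hDv v).toLp _) x := by
      rw [L2.inner_def, integralFun, integralFun,
        ← integral_sub (W.integrable_mul x v) (W'.integrable_mul x v)]
      refine integral_congr_ae ?_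
      filter_upwards [(hDv v).coeFn_toLp] with u hu
      rw [hu]
      simp only [RCLike.inner_apply, conj_trivial]
      ring
    have h2 : ∫ u, (W.toFun u v - W'.toFun u v) ^ 2 = ‖(hDv v).toLp _‖ ^ 2 := by
      rw [norm_sq_eq_integral_sq]
      refine integral_congr_ae ?_
      filter_upwards [(hDv v).coeFn_toLp] with u hu
      rw [hu]
    rw [h1, h2, ← mul_pow, ← sq_abs]
    gcongr
    exact abs_real_inner_le_norm _ _
  have hmeas : StronglyMeasurable fun v => ∫ u, (W.toFun u v - W'.toFun u v) ^ 2 :=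
    StronglyMeasurable.integral_prod_left'
      (f := fun p : unitInterval × unitInterval => (W.toFun p.1 p.2 - W'.toFun p.1 p.2) ^ 2)
      (hD.pow_const 2).stronglyMeasurable
  have hint : Integrable fun v => ∫ u, (W.toFun u v - W'.toFun u v) ^ 2 := by
    refine Integrable.of_bound hmeas.aestronglyMeasurable 1 (.of_forall fun v => ?_)
    have := norm_integral_le_of_norm_le_const (μ := (volume : Measure unitInterval))
      (f := fun u => (W.toFun u v - W'.toFun u v) ^ 2) (.of_forall fun u => hDle2 u v)
    simpa using this
  calc ‖(W.operator - W'.operator) x‖ ^ 2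
      = ∫ v, (W.integralFun x v - W'.integralFun x v) ^ 2 := by
        rw [norm_sq_eq_integral_sq]
        refine integral_congr_ae ?_
        filter_upwards [W.operator_coeFn x, W'.operator_coeFn x,
          Lp.coeFn_sub (W.operator x) (W'.operator x)] with v h1 h2 h3
        rw [sub_apply, h3, Pi.sub_apply, h1, h2]
    _ ≤ ∫ v, (∫ u, (W.toFun u v - W'.toFun u v) ^ 2) * ‖x‖ ^ 2 := by
        refine integral_mono_of_nonneg (.of_forall fun v => sq_nonneg _) (hint.mul_const _)
          (.of_forall hpt)
    _ = (∫ v, ∫ u, (W.toFun u v - W'.toFun u v) ^ 2) * ‖x‖ ^ 2 := integral_mul_const _ _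
    _ ≤ δ ^ 2 * ‖x‖ ^ 2 := by gcongr
    _ = (δ * ‖x‖) ^ 2 := by ring

/-- A contraction `J` that intertwines the quadratic forms of two graphon operators up to `δ`
bounds the eigenvalues of the first, of either sign, by those of the second. -/
theorem abs_eigenvalue_le {W W' : Graphon} (hc : IsCompactOperator W'.operator)
    (J : Lp ℝ 2 (volume : Measure unitInterval) →ₗ[ℝ] Lp ℝ 2 (volume : Measure unitInterval))
    (hJ : ∀ x, ‖J x‖ ≤ ‖x‖) {δ : ℝ} (hδ : 0 ≤ δ)
    (h : ∀ x, |inner ℝ (W.operator x) x - inner ℝ (W'.operator (J x)) (J x)| ≤ δ * ‖x‖ ^ 2)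
    {i : ℤ} (hi : i ≠ 0) : |W.eigenvalue i| ≤ |W'.eigenvalue i| + δ := by
  have hm : i.natAbs ≠ 0 := Int.natAbs_ne_zero.2 hi
  rcases lt_or_gt_of_ne hi with hneg | hpos
  · rw [eigenvalue_of_neg _ hneg, eigenvalue_of_neg _ hneg, abs_neg, abs_neg,
      abs_of_nonneg (posEigenvalue_nonneg _ _), abs_of_nonneg (posEigenvalue_nonneg _ _)]
    have hs : ∀ V : Graphon, (-V.operator).toLinearMap.IsSymmetric := fun V x y => by
      have := V.isSymmetric_operator x y
      simp only [ContinuousLinearMap.coe_coe, neg_apply, inner_neg_left, inner_neg_right] at this ⊢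
      rw [this]
    refine posEigenvalue_le_add (hs W) (hs W') hc.neg J hJ hδ (fun x => ?_) hm
    rw [neg_apply, neg_apply, inner_neg_left, inner_neg_left]
    linarith [(abs_le.1 (h x)).1]
  · rw [eigenvalue_of_pos _ hpos, eigenvalue_of_pos _ hpos,
      abs_of_nonneg (posEigenvalue_nonneg _ _), abs_of_nonneg (posEigenvalue_nonneg _ _)]
    refine posEigenvalue_le_add W.isSymmetric_operator W'.isSymmetric_operator hc J hJ hδ
      (fun x => ?_) hm
    linarith [(abs_le.1 (h x)).2]

/-- Both eigenvalues have the sign of `i`, so only their absolute values matter. -/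
theorem abs_eigenvalue_sub (W W' : Graphon) {i : ℤ} (hi : i ≠ 0) :
    |W.eigenvalue i - W'.eigenvalue i| = |(|W.eigenvalue i| - |W'.eigenvalue i|)| := by
  rcases lt_or_gt_of_ne hi with hneg | hpos
  · have h : ∀ V : Graphon, V.eigenvalue i ≤ 0 := fun V => by
      rw [eigenvalue_of_neg _ hneg]; exact neg_nonpos.2 (posEigenvalue_nonneg _ _)
    rw [abs_of_nonpos (h W), abs_of_nonpos (h W'), ← abs_neg]
    ring_nf
  · have h : ∀ V : Graphon, 0 ≤ V.eigenvalue i := fun V => by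
      rw [eigenvalue_of_pos _ hpos]; exact posEigenvalue_nonneg _ _
    rw [abs_of_nonneg (h W), abs_of_nonneg (h W')]

/-- Weyl's inequality for graphons. -/
theorem abs_eigenvalue_sub_le (W W' : Graphon) (hc : IsCompactOperator W.operator)
    (hc' : IsCompactOperator W'.operator) {δ : ℝ} (hδ : 0 ≤ δ)
    (h : ‖W.operator - W'.operator‖ ≤ δ) {i : ℤ} (hi : i ≠ 0) :
    |W.eigenvalue i - W'.eigenvalue i| ≤ δ := by
  have key : ∀ x, |inner ℝ (W.operator x) x - inner ℝ (W'.operator x) x| ≤ δ * ‖x‖ ^ 2 := by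
    intro x
    rw [← inner_sub_left, ← sub_apply]
    calc |inner ℝ ((W.operator - W'.operator) x) x|
        ≤ ‖(W.operator - W'.operator) x‖ * ‖x‖ := abs_real_inner_le_norm _ _
      _ ≤ (δ * ‖x‖) * ‖x‖ := by
          gcongr
          exact ContinuousLinearMap.le_of_opNorm_le _ h x
      _ = δ * ‖x‖ ^ 2 := by ring
  rw [abs_eigenvalue_sub W W' hi, abs_sub_le_iff]
  have h1 := abs_eigenvalue_le hc' LinearMap.id (fun x => le_rfl) hδ key hi
  have h2 := abs_eigenvalue_le hc LinearMap.id (fun x => le_rfl) hδ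
    (fun x => by rw [abs_sub_comm]; exact key x) hi
  constructor <;> linarith

end Graphon

/-! ### Step graphons -/

theorem volume_regularInterval {n : ℕ} (j : Fin n) :
    volume (regularInterval n j) = ENNReal.ofReal (1 / n) := by
  have hn : (0 : ℝ) < n := by exact_mod_cast j.pos
  have hj : ((j : ℕ) : ℝ) + 1 ≤ n := by exact_mod_cast j.isLt
  let x : unitInterval := ⟨(j : ℝ) / n, by positivity, by rw [div_le_one hn]; linarith⟩
  let y : unitInterval := ⟨((j : ℝ) + 1) / n, by positivity, by rw [div_le_one hn]; linarith⟩
  by_cases h : (j : ℕ) + 1 = n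
  · have e : regularInterval n j = Set.Ici x := by
      ext u
      simp only [regularInterval, h, or_true, and_true, Set.mem_ofPred_eq, Set.mem_Ici]
      exact Iff.rfl
    rw [e, unitInterval.volume_Ici]
    congr 1
    have h' : ((j : ℕ) : ℝ) + 1 = n := by exact_mod_cast h
    have h2 : ((j : ℕ) : ℝ) = n - 1 := by linarith
    simp only [x, h2]
    field_simp
    ring
  · have e : regularInterval n j = Set.Ico x y := by
      ext u
      simp only [regularInterval, h, or_false, Set.mem_ofPred_eq, Set.mem_Ico]
      exact Iff.rfl
    rw [e, unitInterval.volume_Ico]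
    congr 1
    simp only [x, y]
    field_simp
    ring

/-- The normalized indicator function `√n • 1_{I_j}` of the `j`-th interval of the regular
partition, as an element of `L²`. -/
noncomputable def stepVec (n : ℕ) (j : Fin n) : Lp ℝ 2 (volume : Measure unitInterval) :=
  indicatorConstLp 2 (measurableSet_regularInterval n j) (measure_ne_top _ _) (Real.sqrt n)

theorem inner_stepVec {n : ℕ} (j : Fin n) (x : Lp ℝ 2 (volume : Measure unitInterval)) :
    inner ℝ (stepVec n j) x = Real.sqrt n * ∫ u in regularInterval n j, x u := by
  rw [stepVec, L2.inner_indicatorConstLp_eq_inner_setIntegral]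
  simp [mul_comm]

theorem orthonormal_stepVec (n : ℕ) : Orthonormal ℝ (stepVec n) := by
  classical
  rw [orthonormal_iff_ite]
  intro j k
  have hn : (0 : ℝ) < n := by exact_mod_cast j.pos
  rw [stepVec, stepVec, L2.inner_indicatorConstLp_indicatorConstLp]
  split_ifs with h
  · subst h
    rw [Set.inter_self, Measure.real, volume_regularInterval, ENNReal.toReal_ofReal (by positivity)]
    simp only [RCLike.inner_apply, conj_trivial, Real.mul_self_sqrt hn.le, smul_eq_mul]
    field_simp
  · have : regularInterval n j ∩ regularInterval n k = ∅ := by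
      ext u
      simp only [Set.mem_inter_iff, Set.mem_empty_iff_false, iff_false, not_and]
      exact fun h1 h2 => h (regularInterval_eq h1 h2)
    rw [this]
    simp

namespace WeightedGraph

variable {n : ℕ}

theorem operator_inducedGraphon (G : WeightedGraph n)
    (x : Lp ℝ 2 (volume : Measure unitInterval)) :
    G.inducedGraphon.operator x = (1 / n : ℝ) • ∑ j, ∑ k,
      (G.adj j k * inner ℝ (stepVec n j) x) • stepVec n k := by
  refine ext_inner_right ℝ fun y => ?_
  rw [Graphon.inner_operator, inner_smul_left, sum_inner]
  simp only [sum_inner, inner_smul_left, conj_trivial, inner_stepVec]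
  obtain ⟨B, hB⟩ : ∃ B : Fin n → Fin n → ℝ, ∀ j k, G.adj j k = B j k := ⟨G.adj, fun _ _ => rfl⟩
  simp only [hB]
  have hx : Integrable x := (Lp.memLp x).integrable (by norm_num)
  have hy : Integrable y := (Lp.memLp y).integrable (by norm_num)
  have h1 : ∀ (z : unitInterval → ℝ) (j : Fin n) (u : unitInterval),
      (regularInterval n j).indicator 1 u * z u = (regularInterval n j).indicator z u := by
    intro z j u
    by_cases hu : u ∈ regularInterval n j <;> simp [hu]
  have h2 : ∀ u v : unitInterval, G.inducedGraphon.toFun u v * x u * y v =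
      ∑ j, ∑ k, B j k * (regularInterval n j).indicator x u *
        (regularInterval n k).indicator y v := by
    intro u v
    change (∑ j, ∑ k, G.adj j k * (regularInterval n j).indicator 1 u *
      (regularInterval n k).indicator 1 v) * x u * y v = _
    simp only [Finset.sum_mul]
    refine Finset.sum_congr rfl fun j _ => Finset.sum_congr rfl fun k _ => ?_
    rw [← h1 x, ← h1 y, hB]
    ring
  have hxi := fun j => hx.indicator (measurableSet_regularInterval n j)
  have hyi := fun j => hy.indicator (measurableSet_regularInterval n j)
  simp only [h2]
  have h3 : ∀ v, (∫ u, ∑ j, ∑ k, B j k * (regularInterval n j).indicator x u *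
        (regularInterval n k).indicator y v) = ∑ j, ∑ k, B j k *
        (∫ u in regularInterval n j, x u) * (regularInterval n k).indicator y v := by
    intro v
    rw [integral_finsetSum _ fun j _ => integrable_finsetSum _ fun k _ =>
      ((hxi j).const_mul _).mul_const _]
    refine Finset.sum_congr rfl fun j _ => ?_
    rw [integral_finsetSum _ fun k _ => ((hxi j).const_mul _).mul_const _]
    refine Finset.sum_congr rfl fun k _ => ?_
    rw [integral_mul_const, integral_const_mul,
      integral_indicator (measurableSet_regularInterval n j)]
  simp only [h3]
  rw [integral_finsetSum _ fun j _ => integrable_finsetSum _ fun k _ => (hyi k).const_mul _,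
    Finset.mul_sum]
  refine Finset.sum_congr rfl fun j _ => ?_
  rw [integral_finsetSum _ fun k _ => (hyi k).const_mul _, Finset.mul_sum]
  refine Finset.sum_congr rfl fun k _ => ?_
  have hn : (0 : ℝ) < n := by exact_mod_cast j.pos
  rw [integral_const_mul, integral_indicator (measurableSet_regularInterval n k)]
  have hs := Real.mul_self_sqrt hn.le
  field_simp
  rw [Real.sq_sqrt hn.le]

theorem isCompactOperator_inducedGraphon (G : WeightedGraph n) :
    IsCompactOperator G.inducedGraphon.operator := by
  set V : Submodule ℝ (Lp ℝ 2 (volume : Measure unitInterval)) :=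
    Submodule.span ℝ (Set.range (stepVec n)) with hV
  have hfin : FiniteDimensional ℝ V := FiniteDimensional.span_of_finite ℝ (Set.finite_range _)
  have hmem : ∀ x, G.inducedGraphon.operator x ∈ V := by
    intro x
    rw [operator_inducedGraphon]
    exact V.smul_mem _ (V.sum_mem fun j _ => V.sum_mem fun k _ =>
      V.smul_mem _ (Submodule.subset_span ⟨k, rfl⟩))
  have : ProperSpace V := FiniteDimensional.proper ℝ V
  have hc : IsCompactOperator (G.inducedGraphon.operator.codRestrict V hmem) :=
    isCompactOperator_of_locallyCompactSpace_dom (M₂ := V) _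
  exact hc.clm_comp V.subtypeL

theorem inner_operator_inducedGraphon (G : WeightedGraph n)
    (x : Lp ℝ 2 (volume : Measure unitInterval)) :
    inner ℝ (G.inducedGraphon.operator x) x = (1 / n : ℝ) * ∑ j, ∑ k,
      G.adj j k * inner ℝ (stepVec n j) x * inner ℝ (stepVec n k) x := by
  rw [operator_inducedGraphon, inner_smul_left]
  simp only [sum_inner, inner_smul_left, conj_trivial]

/-- If, after a relabelling of the nodes, two adjacency matrices are close as quadratic forms, then
the induced graphons have close eigenvalues. The relabelling is realized on `L²` by the partial
isometry that permutes the normalized indicators of the intervals. -/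
theorem abs_eigenvalue_inducedGraphon_le (G G' : WeightedGraph n) (σ : Equiv.Perm (Fin n))
    {δ : ℝ} (hδ : 0 ≤ δ)
    (h : ∀ c : Fin n → ℝ, |∑ j, ∑ k, (G.adj j k - G'.adj (σ j) (σ k)) * c j * c k| ≤
      n * δ * ∑ j, c j ^ 2) {i : ℤ} (hi : i ≠ 0) :
    |G.inducedGraphon.eigenvalue i| ≤ |G'.inducedGraphon.eigenvalue i| + δ := by
  classical
  let J : Lp ℝ 2 (volume : Measure unitInterval) →ₗ[ℝ] Lp ℝ 2 (volume : Measure unitInterval) :=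
    ∑ j, ((innerSL ℝ (stepVec n j)).toLinearMap).smulRight (stepVec n (σ j))
  have hJ : ∀ x, J x = ∑ j, inner ℝ (stepVec n j) x • stepVec n (σ j) := by
    intro x
    simp [J, LinearMap.sum_apply]
  have hJi : ∀ x k, inner ℝ (stepVec n (σ k)) (J x) = inner ℝ (stepVec n k) x := by
    intro x k
    rw [hJ]
    exact ((orthonormal_stepVec n).comp σ σ.injective).inner_right_fintype _ k
  have hbessel : ∀ x : Lp ℝ 2 (volume : Measure unitInterval),
      ∑ j, inner ℝ (stepVec n j) x ^ 2 ≤ ‖x‖ ^ 2 := by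
    intro x
    have := (orthonormal_stepVec n).sum_inner_products_le x (s := Finset.univ)
    simpa only [Real.norm_eq_abs, sq_abs] using this
  refine Graphon.abs_eigenvalue_le (isCompactOperator_inducedGraphon G') J (fun x => ?_) hδ
    (fun x => ?_) hi
  · refine le_of_sq_le_sq ?_ (norm_nonneg _)
    refine le_trans (le_of_eq ?_) (hbessel x)
    rw [← real_inner_self_eq_norm_sq]
    nth_rewrite 1 [hJ]
    rw [sum_inner]
    refine Finset.sum_congr rfl fun j _ => ?_
    rw [inner_smul_left, hJi, conj_trivial, sq]
  · rw [inner_operator_inducedGraphon, inner_operator_inducedGraphon]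
    rcases Nat.eq_zero_or_pos n with rfl | hn
    · simp only [Finset.univ_eq_empty, Finset.sum_empty, mul_zero, sub_zero, abs_zero]
      positivity
    have hn' : (0 : ℝ) < n := by exact_mod_cast hn
    have e : ∑ j, ∑ k, G'.adj j k * inner ℝ (stepVec n j) (J x) * inner ℝ (stepVec n k) (J x) =
        ∑ j, ∑ k, G'.adj (σ j) (σ k) * inner ℝ (stepVec n j) x * inner ℝ (stepVec n k) x := by
      rw [← Equiv.sum_comp σ]
      refine Finset.sum_congr rfl fun j _ => ?_
      rw [← Equiv.sum_comp σ]
      simp only [hJi]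
    rw [e, ← mul_sub, abs_mul, abs_of_pos (by positivity : (0 : ℝ) < 1 / n),
      ← Finset.sum_sub_distrib]
    simp only [← Finset.sum_sub_distrib, ← sub_mul]
    have := (h fun j => inner ℝ (stepVec n j) x).trans
      (mul_le_mul_of_nonneg_left (hbessel x) (by positivity))
    rw [one_div, inv_mul_le_iff₀ hn', ← mul_assoc]
    exact this

theorem abs_eigenvalue_inducedGraphon_sub_le (G G' : WeightedGraph n) {δ : ℝ} (hδ : 0 ≤ δ)
    (h : ∀ c : Fin n → ℝ, |∑ j, ∑ k, (G.adj j k - G'.adj j k) * c j * c k| ≤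
      n * δ * ∑ j, c j ^ 2) {i : ℤ} (hi : i ≠ 0) :
    |G.inducedGraphon.eigenvalue i - G'.inducedGraphon.eigenvalue i| ≤ δ := by
  rw [Graphon.abs_eigenvalue_sub _ _ hi, abs_sub_le_iff]
  have h1 := abs_eigenvalue_inducedGraphon_le G G' 1 hδ (by simpa using h) hi
  have h2 := abs_eigenvalue_inducedGraphon_le G' G 1 hδ (fun c => by
    rw [← abs_neg, ← Finset.sum_neg_distrib]
    simp only [← Finset.sum_neg_distrib, ← neg_mul, neg_sub]
    exact h c) hi
  constructor <;> linarith

/-- Relabelling the nodes does not change the eigenvalues of the induced graphon. -/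
theorem eigenvalue_inducedGraphon_perm (G G' : WeightedGraph n) (σ : Equiv.Perm (Fin n))
    (h : ∀ j k, G.adj j k = G'.adj (σ j) (σ k)) {i : ℤ} (hi : i ≠ 0) :
    G.inducedGraphon.eigenvalue i = G'.inducedGraphon.eigenvalue i := by
  rw [← sub_eq_zero, ← abs_nonpos_iff, Graphon.abs_eigenvalue_sub _ _ hi, abs_sub_le_iff]
  have h1 := abs_eigenvalue_inducedGraphon_le G G' σ le_rfl (by simp [h]) hi
  have h2 := abs_eigenvalue_inducedGraphon_le G' G σ⁻¹ le_rfl (by simp [h]) hi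
  constructor <;> linarith

end WeightedGraph

/-! ### Step approximation of piecewise Lipschitz graphons -/

theorem exists_mem_regularInterval {n : ℕ} (hn : 0 < n) (x : unitInterval) :
    ∃ j, x ∈ regularInterval n j := by
  have hn' : (0 : ℝ) < n := by exact_mod_cast hn
  have hx0 : 0 ≤ (x : ℝ) * n := mul_nonneg x.2.1 hn'.le
  by_cases h : ⌊(x : ℝ) * n⌋₊ < n
  · refine ⟨⟨_, h⟩, ?_, Or.inl ?_⟩
    · rw [div_le_iff₀ hn']
      exact Nat.floor_le hx0
    · rw [lt_div_iff₀ hn']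
      exact Nat.lt_floor_add_one _
  · refine ⟨⟨n - 1, by omega⟩, ?_, Or.inr (by simp; omega)⟩
    have h1 : (n : ℝ) ≤ (x : ℝ) * n := (Nat.le_floor_iff hx0).1 (not_lt.1 h)
    have h2 : (1 : ℝ) ≤ x := by
      by_contra! hlt
      nlinarith
    refine le_trans ?_ h2
    rw [div_le_one hn']
    exact_mod_cast Nat.sub_le n 1

theorem measurableSet_near (r b : ℝ) : MeasurableSet {x : unitInterval | |(x : ℝ) - b| ≤ r} :=
  measurableSet_le (by fun_prop) measurable_const

theorem volume_real_near_le {r : ℝ} (hr : 0 ≤ r) (b : ℝ) :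
    (volume : Measure unitInterval).real {x | |(x : ℝ) - b| ≤ r} ≤ 2 * r := by
  rw [Measure.real, unitInterval.volume_apply]
  refine ENNReal.toReal_le_of_le_ofReal (by positivity) ?_
  calc volume (Subtype.val '' {x : unitInterval | |(x : ℝ) - b| ≤ r})
      ≤ volume (Set.Icc (b - r) (b + r)) := by
        refine measure_mono ?_
        rintro _ ⟨x, hx, rfl⟩
        have hx' : |(x : ℝ) - b| ≤ r := hx
        have := abs_le.1 hx'
        constructor <;> linarith [this.1, this.2]
    _ = ENNReal.ofReal (2 * r) := by rw [Real.volume_Icc]; ring_nf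

theorem exists_piece {K : ℕ} {α : Fin (K + 1) → ℝ} (h0 : α 0 = 0) (h1 : α (Fin.last K) = 1)
    {x : unitInterval} (hx : ∀ k, (x : ℝ) ≠ α k) :
    ∃ k : Fin K, (x : ℝ) ∈ Set.Ioo (α k.castSucc) (α k.succ) := by
  by_contra! h
  have key : ∀ k : Fin (K + 1), α k < x := by
    intro k
    induction k using Fin.induction with
    | zero => exact lt_of_le_of_ne (h0 ▸ x.2.1) (hx 0).symm
    | succ k ih =>
      have := h k
      rw [Set.mem_Ioo, not_and, not_lt] at this
      exact lt_of_le_of_ne (this ih) (hx _).symm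
  have h2 := key (Fin.last K)
  rw [h1] at h2
  exact absurd x.2.2 (not_le.2 h2)

namespace Graphon

theorem inducedGraphon_apply {n : ℕ} (G : WeightedGraph n) {j k : Fin n} {x y : unitInterval}
    (hx : x ∈ regularInterval n j) (hy : y ∈ regularInterval n k) :
    G.inducedGraphon.toFun x y = G.adj j k := by
  change (∑ j, ∑ k, G.adj j k * (regularInterval n j).indicator 1 x *
      (regularInterval n k).indicator 1 y) = _
  rw [Finset.sum_eq_single j, Finset.sum_eq_single k]
  · simp [hx, hy]
  · intro k' _ hne
    rw [Set.indicator_of_notMem (fun h => hne (regularInterval_eq h hy)), mul_zero]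
  · simp
  · intro j' _ hne
    refine Finset.sum_eq_zero fun k' _ => ?_
    rw [Set.indicator_of_notMem (fun h => hne (regularInterval_eq h hx)), mul_zero, zero_mul]
  · simp

theorem sq_sub_le_one (W W' : Graphon) (x y : unitInterval) :
    (W.toFun x y - W'.toFun x y) ^ 2 ≤ 1 := by
  have h1 := W.mem_Icc x y
  have h2 := W'.mem_Icc x y
  rw [sq_le_one_iff_abs_le_one, abs_le]
  constructor <;> linarith [h1.1, h1.2, h2.1, h2.2]

/-- If the sample points are within `r` of the corresponding intervals of the regular partition,
the induced graphon of the weighted sample is close to `W` in `L²`. The two differ by at most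
`2 |L| r` unless one coordinate is within `r` of a breakpoint or the point lies in a diagonal
block. -/
theorem integral_sq_weightedSample_sub_le {W : Graphon} {K : ℕ} {L : ℝ}
    (hW : W.IsPiecewiseLipschitz K L) {n : ℕ} (hn : 0 < n) (loops : Bool)
    (u : Fin n → unitInterval) {r : ℝ} (hr : 0 ≤ r)
    (hu : ∀ j, ∀ x ∈ regularInterval n j, |(u j : ℝ) - x| ≤ r) :
    ∫ v, ∫ z, ((W.weightedSample loops u).inducedGraphon.toFun z v - W.toFun z v) ^ 2 ≤
      4 * L ^ 2 * r ^ 2 + 4 * (K + 1) * r + 1 / n := by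
  obtain ⟨α, -, h0, h1, hlip⟩ := hW
  set W' := (W.weightedSample loops u).inducedGraphon with hW'
  have hn' : (0 : ℝ) < n := by exact_mod_cast hn
  set N : Set unitInterval := ⋃ k, {x | |(x : ℝ) - α k| ≤ r} with hN
  have hNm : MeasurableSet N := MeasurableSet.iUnion fun k => measurableSet_near r (α k)
  have hNv : (volume : Measure unitInterval).real N ≤ 2 * (K + 1) * r := by
    refine (measureReal_iUnion_fintype_le _).trans ?_
    refine (Finset.sum_le_sum fun k _ => volume_real_near_le hr (α k)).trans ?_
    simp only [Finset.sum_const, Finset.card_univ, Fintype.card_fin, nsmul_eq_mul]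
    push_cast
    linarith
  -- away from the breakpoints, a point and its sample point lie in the same piece
  have hpiece : ∀ x ∉ N, ∀ j, x ∈ regularInterval n j → ∃ k : Fin K,
      (x : ℝ) ∈ Set.Ioo (α k.castSucc) (α k.succ) ∧
      (u j : ℝ) ∈ Set.Ioo (α k.castSucc) (α k.succ) := by
    intro x hx j hj
    have hx' : ∀ k, r < |(x : ℝ) - α k| := by
      intro k
      by_contra! h
      exact hx (Set.mem_iUnion.2 ⟨k, h⟩)
    obtain ⟨k, hk⟩ := exists_piece h0 h1 (x := x) (fun k h => by
      have := hx' k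
      rw [h, sub_self, abs_zero] at this
      linarith)
    refine ⟨k, hk, ?_⟩
    have h2 := hx' k.castSucc
    have h3 := hx' k.succ
    rw [abs_of_pos (sub_pos.2 hk.1)] at h2
    rw [abs_of_neg (sub_neg.2 hk.2)] at h3
    have h4 := abs_le.1 (hu j x hj)
    constructor <;> linarith [h4.1, h4.2]
  set c : ℝ := 4 * L ^ 2 * r ^ 2 with hc
  have hc0 : 0 ≤ c := by positivity
  let χ : Set unitInterval → unitInterval → ℝ := fun s => s.indicator 1
  have hχ0 : ∀ s x, 0 ≤ χ s x := fun s x => Set.indicator_nonneg (fun _ _ => zero_le_one) x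
  have hχ1 : ∀ {s x}, x ∈ s → χ s x = 1 := fun h => Set.indicator_of_mem h _
  have hχi : ∀ {s}, MeasurableSet s → Integrable (χ s) := fun h =>
    (integrable_const (1 : ℝ)).indicator h
  have hχint : ∀ {s}, MeasurableSet s → ∫ x, χ s x = (volume : Measure unitInterval).real s :=
    fun h => integral_indicator_one h
  have hpt : ∀ z v, (W'.toFun z v - W.toFun z v) ^ 2 ≤
      c + χ N z + χ N v + ∑ j, χ (regularInterval n j) z * χ (regularInterval n j) v := by
    intro z v
    have hS : 0 ≤ ∑ j, χ (regularInterval n j) z * χ (regularInterval n j) v :=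
      Finset.sum_nonneg fun j _ => mul_nonneg (hχ0 _ _) (hχ0 _ _)
    have hle1 := W'.sq_sub_le_one W z v
    by_cases hz : z ∈ N
    · have := hχ1 hz
      linarith [hχ0 N v]
    by_cases hv : v ∈ N
    · have := hχ1 hv
      linarith [hχ0 N z]
    obtain ⟨j, hj⟩ := exists_mem_regularInterval hn z
    obtain ⟨k, hk⟩ := exists_mem_regularInterval hn v
    by_cases hjk : j = k
    · subst hjk
      have : 1 ≤ ∑ i, χ (regularInterval n i) z * χ (regularInterval n i) v := by
        refine le_trans ?_ (Finset.single_le_sum (fun i _ => mul_nonneg (hχ0 _ _) (hχ0 _ _))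
          (Finset.mem_univ j))
        rw [hχ1 hj, hχ1 hk, mul_one]
      linarith [hχ0 N z, hχ0 N v]
    have hval : W'.toFun z v = W.toFun (u j) (u k) := by
      rw [hW', inducedGraphon_apply _ hj hk]
      exact if_neg fun h => hjk h.1
    obtain ⟨p, hp1, hp2⟩ := hpiece z hz j hj
    obtain ⟨q, hq1, hq2⟩ := hpiece v hv k hk
    have h2 := hlip p q (u j) (u k) z v hp2 hp1 hq2 hq1
    have h3 : |W.toFun (u j) (u k) - W.toFun z v| ≤ |L| * (2 * r) := by
      refine h2.trans ?_
      have := hu j z hj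
      have := hu k v hk
      gcongr
      · exact le_abs_self L
      · linarith
    have h4 : (W'.toFun z v - W.toFun z v) ^ 2 ≤ c := by
      rw [hval, ← sq_abs]
      calc |W.toFun (u j) (u k) - W.toFun z v| ^ 2 ≤ (|L| * (2 * r)) ^ 2 := by gcongr
        _ = c := by rw [mul_pow, sq_abs, hc]; ring
    linarith [hχ0 N z, hχ0 N v]
  have hblock : ∀ j, ∫ x, χ (regularInterval n j) x = 1 / n := fun j => by
    rw [hχint (measurableSet_regularInterval n j), Measure.real, volume_regularInterval,
      ENNReal.toReal_ofReal (by positivity)]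
  have hri := fun j => hχi (measurableSet_regularInterval n j)
  have hinner : ∀ v, ∫ z, (W'.toFun z v - W.toFun z v) ^ 2 ≤
      c + (volume : Measure unitInterval).real N + χ N v +
        ∑ j, 1 / n * χ (regularInterval n j) v := by
    intro v
    have i1 : Integrable fun z => c + χ N z := (integrable_const c).add (hχi hNm)
    have i2 : Integrable fun z => c + χ N z + χ N v := i1.add (integrable_const _)
    have i3 : Integrable fun z =>
        ∑ j, χ (regularInterval n j) z * χ (regularInterval n j) v :=
      integrable_finsetSum _ fun j _ => (hri j).mul_const _
    refine (integral_mono_of_nonneg (.of_forall fun z => sq_nonneg _) (i2.add i3)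
      (.of_forall fun z => hpt z v)).trans (le_of_eq ?_)
    simp only [Pi.add_apply]
    rw [integral_add i2 i3, integral_add i1 (integrable_const _),
      integral_add (integrable_const _) (hχi hNm), hχint hNm,
      integral_finsetSum _ fun j _ => (hri j).mul_const _]
    simp only [integral_mul_const, hblock, integral_const, probReal_univ, smul_eq_mul, one_mul]
  have j1 : Integrable fun v => c + (volume : Measure unitInterval).real N + χ N v :=
    (integrable_const _).add (hχi hNm)
  have j2 : Integrable fun v => ∑ j, 1 / n * χ (regularInterval n j) v :=
    integrable_finsetSum _ fun j _ => (hri j).const_mul _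
  refine (integral_mono_of_nonneg (.of_forall fun v => integral_nonneg fun z => sq_nonneg _)
    (j1.add j2) (.of_forall hinner)).trans ?_
  simp only [Pi.add_apply]
  rw [integral_add j1 j2, integral_add (integrable_const _) (hχi hNm), hχint hNm,
    integral_finsetSum _ fun j _ => (hri j).const_mul _]
  simp only [integral_const_mul, hblock, integral_const, probReal_univ, smul_eq_mul, one_mul,
    Finset.sum_const, Finset.card_univ, Fintype.card_fin, nsmul_eq_mul]
  have : (n : ℝ) * (1 / n * (1 / n)) = 1 / n := by field_simp
  rw [this]
  linarith

/-- The operator of a piecewise Lipschitz graphon is compact, as the norm limit of the finite-rank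
operators of its weighted samples at the points `j / n`. -/
theorem isCompactOperator_of_isPiecewiseLipschitz {W : Graphon} {K : ℕ} {L : ℝ}
    (hW : W.IsPiecewiseLipschitz K L) : IsCompactOperator W.operator := by
  let u : (n : ℕ) → Fin (n + 1) → unitInterval := fun n j =>
    ⟨(j : ℝ) / ((n + 1 : ℕ) : ℝ), by positivity, by
      rw [div_le_one (by positivity)]; exact_mod_cast j.isLt.le⟩
  let G : (n : ℕ) → WeightedGraph (n + 1) := fun n => W.weightedSample true (u n)
  let b : ℕ → ℝ := fun n => 4 * L ^ 2 * (1 / ((n : ℝ) + 1)) ^ 2 +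
    4 * (K + 1) * (1 / ((n : ℝ) + 1)) + 1 / ((n : ℝ) + 1)
  have hb : Filter.Tendsto (fun n => Real.sqrt (b n)) Filter.atTop (nhds 0) := by
    have h1 := tendsto_one_div_add_atTop_nhds_zero_nat (𝕜 := ℝ)
    have h2 := ((((h1.pow 2).const_mul (4 * L ^ 2)).add (h1.const_mul (4 * ((K : ℝ) + 1)))).add
      h1).sqrt
    simpa [b] using h2
  refine isCompactOperator_of_tendsto (l := Filter.atTop)
    (F := fun n => (G n).inducedGraphon.operator) ?_
    (.of_forall fun n => (G n).isCompactOperator_inducedGraphon)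
  rw [tendsto_iff_norm_sub_tendsto_zero]
  refine squeeze_zero (fun n => norm_nonneg _) (fun n => ?_) hb
  have hbn : 0 ≤ b n := by positivity
  refine norm_operator_sub_le _ _ (Real.sqrt_nonneg _) ?_
  rw [Real.sq_sqrt hbn]
  have := integral_sq_weightedSample_sub_le hW n.succ_pos true (u n) (r := 1 / ((n : ℝ) + 1))
    (by positivity) (fun j x hx => ?_)
  · simpa only [Nat.cast_succ] using this
  · have hx2 : (x : ℝ) ≤ ((j : ℝ) + 1) / ((n + 1 : ℕ) : ℝ) := by
      rcases hx.2 with h | h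
      · exact h.le
      · have h' : ((j : ℕ) : ℝ) + 1 = ((n + 1 : ℕ) : ℝ) := by exact_mod_cast h
        rw [h', div_self (by positivity)]
        exact x.2.2
    have hx1 := hx.1
    rw [add_div] at hx2
    change |(j : ℝ) / ((n + 1 : ℕ) : ℝ) - x| ≤ _
    push_cast at hx1 hx2 ⊢
    rw [abs_le]
    constructor
    · linarith
    · have : (0 : ℝ) ≤ 1 / ((n : ℝ) + 1) := by positivity
      linarith

end Graphon

/-! ### Concentration of sums of bounded variables -/

section Concentration

open ProbabilityTheory

variable {ι : Type*} [Fintype ι]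

/-- Functions of disjoint sets of independent uniform coordinates are independent. -/
theorem indepFun_of_disjoint_dependence {S T : Finset ι} (hST : Disjoint S T)
    {F G : (ι → unitInterval) → ℝ} (hF : Measurable F) (hG : Measurable G)
    (hFS : ∀ ω ω', (∀ e ∈ S, ω e = ω' e) → F ω = F ω')
    (hGT : ∀ ω ω', (∀ e ∈ T, ω e = ω' e) → G ω = G ω') :
    IndepFun F G (volume : Measure (ι → unitInterval)) := by
  classical
  have hind : iIndepFun (fun (i : ι) (ω : ι → unitInterval) => ω i) volume :=
    iIndepFun_pi (X := fun _ x => x) (fun _ => aemeasurable_id)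
  have h := hind.indepFun_finset S T hST (fun i => measurable_pi_apply i)
  -- a function that depends only on `R` factors through the restriction to `R`
  let ext : (R : Finset ι) → (R → unitInterval) → ι → unitInterval :=
    fun R a e => if h : e ∈ R then a ⟨e, h⟩ else 0
  have hext : ∀ R, Measurable (ext R) := by
    intro R
    refine measurable_pi_lambda _ fun e => ?_
    by_cases he : e ∈ R
    · simpa [ext, he] using measurable_pi_apply (⟨e, he⟩ : R)
    · simp [ext, he]
  have h2 := h.comp (hF.comp (hext S)) (hG.comp (hext T))
  have e1 : (F ∘ ext S) ∘ (fun ω (i : S) => ω i) = F := by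
    funext ω
    exact hFS _ _ fun e he => by simp [ext, he]
  have e2 : (G ∘ ext T) ∘ (fun ω (i : T) => ω i) = G := by
    funext ω
    exact hGT _ _ fun e he => by simp [ext, he]
  rwa [e1, e2] at h2

/-- Centred variables bounded by `1` that depend on disjoint sets of independent uniform
coordinates have a sub-Gaussian sum. -/
theorem hasSubgaussianMGF_sum_of_disjoint_dependence {κ : Type*} {X : κ → (ι → unitInterval) → ℝ}
    {S : κ → Finset ι} (hS : ∀ k l, k ≠ l → Disjoint (S k) (S l))
    (hX : ∀ k, Measurable (X k)) (hXS : ∀ k ω ω', (∀ e ∈ S k, ω e = ω' e) → X k ω = X k ω')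
    (hb : ∀ k ω, |X k ω| ≤ 1) (h0 : ∀ k, ∫ ω, X k ω = 0) (s : Finset κ) :
    HasSubgaussianMGF (fun ω => ∑ k ∈ s, X k ω) (s.card : NNReal) volume := by
  classical
  have hone : ∀ k, HasSubgaussianMGF (X k) 1 volume := by
    intro k
    have := hasSubgaussianMGF_of_mem_Icc_of_integral_eq_zero (a := -1) (b := 1)
      (hX k).aemeasurable (.of_forall fun ω => abs_le.1 (hb k ω)) (h0 k)
    have e : ((‖(1 : ℝ) - (-1)‖₊ / 2) ^ 2 : NNReal) = 1 := by
      have : ‖(1 : ℝ) - (-1)‖₊ = 2 := by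
        ext; norm_num
      rw [this]; norm_num
    rwa [e] at this
  induction s using Finset.induction_on with
  | empty => simp
  | insert k s hk ih =>
    simp_rw [Finset.sum_insert hk, Finset.card_insert_of_notMem hk]
    have hdis : Disjoint (S k) (s.biUnion S) := by
      rw [Finset.disjoint_biUnion_right]
      exact fun l hl => hS k l fun h => hk (h ▸ hl)
    have hind : IndepFun (X k) (fun ω => ∑ l ∈ s, X l ω)
        (volume : Measure (ι → unitInterval)) := by
      refine indepFun_of_disjoint_dependence hdis (hX k)
        (Finset.measurable_fun_sum _ fun l _ => hX l) (hXS k) fun ω ω' h => ?_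
      exact Finset.sum_congr rfl fun l hl => hXS l ω ω' fun e he =>
        h e (Finset.mem_biUnion.2 ⟨l, hl, he⟩)
    have := (hone k).add_of_indepFun ih hind
    rw [add_comm] at this
    exact_mod_cast this

/-- The sub-Gaussian tail at the level where it is `2 n ^ (-b)`. -/
theorem measure_abs_ge_le_of_hasSubgaussianMGF {Ω : Type*} [MeasurableSpace Ω] {μ : Measure Ω}
    [IsProbabilityMeasure μ] {X : Ω → ℝ} {n : ℕ} (hn : 0 < n)
    (hX : HasSubgaussianMGF X (n : NNReal) μ) {b : ℝ} (hb : 0 ≤ b) :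
    μ {ω | Real.sqrt (2 * b * n * Real.log n) ≤ |X ω|} ≤ 2 * ENNReal.ofReal ((n : ℝ) ^ (-b)) := by
  set η := Real.sqrt (2 * b * n * Real.log n) with hη
  have hn' : (0 : ℝ) < n := by exact_mod_cast hn
  have hlog : 0 ≤ Real.log n := Real.log_natCast_nonneg n
  have e : Real.exp (-η ^ 2 / (2 * ((n : NNReal) : ℝ))) = (n : ℝ) ^ (-b) := by
    rw [hη, Real.sq_sqrt (by positivity), Real.rpow_def_of_pos hn']
    congr 1
    rw [NNReal.coe_natCast]
    field_simp
  have h1 := hX.measure_ge_le (Real.sqrt_nonneg (2 * b * n * Real.log n))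
  have h2 := hX.neg.measure_ge_le (Real.sqrt_nonneg (2 * b * n * Real.log n))
  rw [← hη, e] at h1 h2
  have h3 : ∀ s : Set Ω, μ.real s ≤ (n : ℝ) ^ (-b) → μ s ≤ ENNReal.ofReal ((n : ℝ) ^ (-b)) :=
    fun s hs => (ENNReal.le_ofReal_iff_toReal_le (measure_ne_top _ _) (by positivity)).2 hs
  refine (measure_mono (t := {ω | η ≤ X ω} ∪ {ω | η ≤ (-X) ω}) fun ω hω => ?_).trans
    ((measure_union_le _ _).trans ?_)
  · have hω' : η ≤ |X ω| := hω
    exact le_abs.1 hω'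
  · rw [two_mul]
    exact add_le_add (h3 _ h1) (h3 _ h2)

theorem integral_eval_pi {f : unitInterval → ℝ} (hf : Measurable f) (i : ι) :
    ∫ ω : ι → unitInterval, f (ω i) = ∫ x, f x := by
  have h := measurePreserving_eval (fun _ : ι => (volume : Measure unitInterval)) i
  rw [← h.map_eq, integral_map h.measurable.aemeasurable hf.aestronglyMeasurable]
  rfl

/-- The centred indicator `1[x < w] - w` of an event of probability `w`. -/
noncomputable def centredIndicator (w : ℝ) (x : unitInterval) : ℝ :=
  (if (x : ℝ) < w then 1 else 0) - w

theorem measurable_centredIndicator : Measurable (Function.uncurry centredIndicator) := by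
  unfold centredIndicator Function.uncurry
  refine Measurable.sub (Measurable.ite ?_ measurable_const measurable_const) measurable_fst
  exact measurableSet_lt (by fun_prop) (by fun_prop)

theorem abs_centredIndicator_le {w : ℝ} (hw : w ∈ Set.Icc (0 : ℝ) 1) (x : unitInterval) :
    |centredIndicator w x| ≤ 1 := by
  unfold centredIndicator
  rw [abs_le]
  split_ifs <;> constructor <;> linarith [hw.1, hw.2]

theorem integral_centredIndicator {w : ℝ} (hw : w ∈ Set.Icc (0 : ℝ) 1) :
    ∫ x, centredIndicator w x = 0 := by
  have hm : MeasurableSet (Set.Iio (⟨w, hw⟩ : unitInterval)) := measurableSet_Iio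
  have e : ∀ x : unitInterval, (if (x : ℝ) < w then (1 : ℝ) else 0) =
      (Set.Iio (⟨w, hw⟩ : unitInterval)).indicator 1 x := by
    intro x
    rw [Set.indicator_apply]
    rfl
  have hi : Integrable ((Set.Iio (⟨w, hw⟩ : unitInterval)).indicator (1 : unitInterval → ℝ)) :=
    (integrable_const (1 : ℝ)).indicator hm
  simp only [centredIndicator, e]
  rw [integral_sub hi (integrable_const _), integral_indicator_one hm, Measure.real,
    unitInterval.volume_Iio, ENNReal.toReal_ofReal hw.1]
  simp

end Concentration

/-! ### Order statistics of uniform samples -/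

open Classical in
/-- The number of sample points in `[0, t]`. -/
noncomputable def sampleCount {n : ℕ} (u : Fin n → unitInterval) (t : ℝ) : ℕ :=
  (Finset.univ.filter fun i => (u i : ℝ) ≤ t).card

theorem sampleCount_comp_perm {n : ℕ} (u : Fin n → unitInterval) (σ : Equiv.Perm (Fin n)) (t : ℝ) :
    sampleCount (u ∘ σ) t = sampleCount u t := by
  classical
  refine Finset.card_bij (fun i _ => σ i) ?_ (fun _ _ _ _ h => σ.injective h) ?_
  · intro i hi
    simpa using hi
  · intro i hi
    exact ⟨σ.symm i, by simpa using hi, by simp⟩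

/-- If the counts of the sample points in the intervals `[0, k / n]` are correct up to `η`, then
the sorted sample points are close to the regular grid. -/
theorem abs_sort_sub_le {n : ℕ} (u : Fin n → unitInterval) {η : ℝ} (hη : 0 ≤ η)
    (h : ∀ k : ℕ, k ≤ n → |(sampleCount u (k / n) : ℝ) - k| ≤ η) (j : Fin n) {x : unitInterval}
    (hx : x ∈ regularInterval n j) : |(u (Tuple.sort u j) : ℝ) - x| ≤ (η + 2) / n := by
  classical
  have hn : (0 : ℝ) < n := by exact_mod_cast j.pos
  have hmono : Monotone fun i => ((u ∘ Tuple.sort u) i : ℝ) := fun i k hik =>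
    Tuple.monotone_sort u hik
  have hiff : ∀ t : ℝ, (j : ℕ) < sampleCount u t ↔ (u (Tuple.sort u j) : ℝ) ≤ t := by
    intro t
    rw [← sampleCount_comp_perm u (Tuple.sort u)]
    have := Tuple.lt_card_le_iff_apply_le_of_monotone (a := t) (j := j) hmono
    unfold sampleCount
    convert! this using 3
  set y : ℝ := (u (Tuple.sort u j) : ℝ) with hy
  have hy0 : 0 ≤ y := (u (Tuple.sort u j)).2.1
  have hy1 : y ≤ 1 := (u (Tuple.sort u j)).2.2
  have hx1 : (j : ℝ) ≤ x * n := (div_le_iff₀ hn).1 hx.1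
  have hx2 : (x : ℝ) * n ≤ j + 1 := by
    rcases hx.2 with h' | h'
    · exact ((lt_div_iff₀ hn).1 h').le
    · have h2 : ((j : ℕ) : ℝ) + 1 = n := by exact_mod_cast h'
      rw [h2]
      nlinarith [x.2.2]
  -- the count at `j + ⌊η⌋ + 1` exceeds `j`; if that index is beyond `n` the bound is trivial
  have hup : y * n ≤ j + η + 1 := by
    by_cases hk : (j : ℕ) + ⌊η⌋₊ + 1 ≤ n
    · have h1 := (abs_le.1 (h _ hk)).1
      have h2 : (j : ℕ) < sampleCount u (((j : ℕ) + ⌊η⌋₊ + 1 : ℕ) / n) := by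
        have := Nat.lt_floor_add_one η
        have h3 : ((j : ℕ) : ℝ) < sampleCount u (((j : ℕ) + ⌊η⌋₊ + 1 : ℕ) / n) := by
          push_cast at h1 ⊢
          linarith
        exact_mod_cast h3
      have h3 := (le_div_iff₀ hn).1 ((hiff _).1 h2)
      push_cast at h3
      linarith [Nat.floor_le hη]
    · have h1 : (n : ℝ) < ((j : ℕ) + ⌊η⌋₊ + 1 : ℕ) := by exact_mod_cast not_le.1 hk
      push_cast at h1
      nlinarith [Nat.floor_le hη]
  have hlow : j - η - 1 ≤ y * n := by
    have hk : ⌈y * n⌉₊ ≤ n := Nat.ceil_le.2 (by nlinarith)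
    have h1 := (abs_le.1 (h _ hk)).2
    have h2 : (j : ℕ) < sampleCount u ((⌈y * n⌉₊ : ℕ) / n) :=
      (hiff _).2 ((le_div_iff₀ hn).2 (Nat.le_ceil _))
    have h3 : ((j : ℕ) : ℝ) < sampleCount u ((⌈y * n⌉₊ : ℕ) / n) := by exact_mod_cast h2
    have h4 := Nat.ceil_lt_add_one (mul_nonneg hy0 hn.le)
    linarith
  have e : |y - x| * n = |(y - x) * n| := by rw [abs_mul, abs_of_pos hn]
  rw [le_div_iff₀ hn, e, abs_le]
  constructor <;> nlinarith

/-- Hoeffding's inequality for the number of sample points in an interval. -/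
theorem volume_sampleCount_le {n k : ℕ} (hn : 0 < n) (hk : k ≤ n) {b : ℝ} (hb : 0 ≤ b) :
    (volume : Measure (Fin n → unitInterval))
      {u | Real.sqrt (2 * b * n * Real.log n) ≤ |(sampleCount u (k / n) : ℝ) - k|} ≤
      2 * ENNReal.ofReal ((n : ℝ) ^ (-b)) := by
  classical
  have hn' : (0 : ℝ) < n := by exact_mod_cast hn
  have hk0 : (k : ℝ) / n ∈ Set.Icc (0 : ℝ) 1 :=
    ⟨by positivity, by rw [div_le_one hn']; exact_mod_cast hk⟩
  set p : unitInterval := ⟨(k : ℝ) / n, hk0⟩ with hp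
  let g : unitInterval → ℝ := fun x => (Set.Iic p).indicator 1 x - p
  have hg : Measurable g := (measurable_one.indicator measurableSet_Iic).sub measurable_const
  have hgb : ∀ x, |g x| ≤ 1 := by
    intro x
    have h0 := p.2.1
    have h1 := p.2.2
    by_cases hx : x ∈ Set.Iic p <;> simp only [g, hx, Set.indicator_of_mem, Pi.one_apply,
      Set.indicator_of_notMem, not_false_eq_true] <;> rw [abs_le] <;> constructor <;> linarith
  have hg0 : ∫ x, g x = 0 := by
    have hi : Integrable ((Set.Iic p).indicator (1 : unitInterval → ℝ)) :=
      (integrable_const (1 : ℝ)).indicator measurableSet_Iic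
    simp only [g]
    rw [integral_sub hi (integrable_const _), integral_indicator_one measurableSet_Iic,
      Measure.real, unitInterval.volume_Iic, ENNReal.toReal_ofReal p.2.1]
    simp
  have hs := hasSubgaussianMGF_sum_of_disjoint_dependence (ι := Fin n)
    (X := fun i ω => g (ω i)) (S := fun i => {i})
    (fun i j hij => by simpa using hij) (fun i => hg.comp (measurable_pi_apply i))
    (fun i ω ω' h => by rw [h i (by simp)]) (fun i ω => hgb _)
    (fun i => by rw [integral_eval_pi hg, hg0]) Finset.univ
  rw [Finset.card_univ, Fintype.card_fin] at hs
  have := measure_abs_ge_le_of_hasSubgaussianMGF hn hs hb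
  convert! this using 6 with u
  rw [Finset.sum_sub_distrib, sampleCount, Finset.card_filter]
  simp only [Finset.sum_const, Finset.card_univ, Fintype.card_fin, nsmul_eq_mul, hp]
  push_cast
  congr 1
  field_simp

/-! ### The noise of the stochastic sample -/

/-- The square of a symmetric matrix bounds its quadratic form: if the off-diagonal entries of
`M²`, without the contributions of the diagonal of `M`, are at most `B`, then the quadratic form
of `M` is at most `√(n (B + 3))`. -/
theorem abs_quadratic_form_le {n : ℕ} {M : Fin n → Fin n → ℝ} (hsymm : ∀ i j, M i j = M j i)
    (hM : ∀ i j, |M i j| ≤ 1) {B D : ℝ} (hD : 0 ≤ D)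
    (hB : ∀ i j, i ≠ j → |∑ k, if k = i ∨ k = j then 0 else M i k * M k j| ≤ B)
    (hB0 : 0 ≤ B) (hBD : n * (B + 3) ≤ D ^ 2) (c : Fin n → ℝ) :
    |∑ j, ∑ k, M j k * c j * c k| ≤ D * ∑ j, c j ^ 2 := by
  have hterm : ∀ i j k, |M i k * M k j| ≤ 1 := fun i j k => by
    rw [abs_mul]
    exact mul_le_one₀ (hM _ _) (abs_nonneg _) (hM _ _)
  set R : Fin n → Fin n → ℝ := fun i j => ∑ k, M i k * M k j with hR
  have hRle : ∀ i j, |R i j| ≤ (B + 2) + if i = j then (n : ℝ) else 0 := by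
    intro i j
    split_ifs with hij
    · have : |R i j| ≤ n := by
        refine (Finset.abs_sum_le_sum_abs _ _).trans ?_
        refine (Finset.sum_le_sum fun k _ => hterm i j k).trans ?_
        simp
      linarith
    · have hsplit : R i j = (∑ k, if k = i ∨ k = j then 0 else M i k * M k j) +
          ∑ k, if k = i ∨ k = j then M i k * M k j else 0 := by
        rw [← Finset.sum_add_distrib]
        refine Finset.sum_congr rfl fun k _ => ?_
        split_ifs <;> simp
      have h2 : |∑ k, if k = i ∨ k = j then M i k * M k j else 0| ≤ 2 := by
        rw [← Finset.sum_filter]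
        refine (Finset.abs_sum_le_sum_abs _ _).trans ?_
        refine (Finset.sum_le_sum fun k _ => hterm i j k).trans ?_
        have hsub : (Finset.univ.filter fun k => k = i ∨ k = j) ⊆ {i, j} := by
          intro k hk
          simpa using hk
        have := (Finset.card_le_card hsub).trans Finset.card_le_two
        simp only [Finset.sum_const, nsmul_eq_mul, mul_one]
        exact_mod_cast this
      rw [hsplit, add_zero]
      exact (abs_add_le _ _).trans (add_le_add (hB i j hij) h2)
  set y : Fin n → ℝ := fun j => ∑ k, M j k * c k with hy
  set Q : ℝ := ∑ j, c j ^ 2 with hQ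
  have hQ0 : 0 ≤ Q := Finset.sum_nonneg fun j _ => sq_nonneg _
  -- the squared norm of `M c` is the quadratic form of `M²`
  have hyR : ∑ j, y j ^ 2 = ∑ k, ∑ l, c k * c l * R k l := by
    have : ∀ j, y j ^ 2 = ∑ k, ∑ l, c k * c l * (M k j * M j l) := by
      intro j
      rw [sq, hy, Finset.sum_mul_sum]
      refine Finset.sum_congr rfl fun k _ => Finset.sum_congr rfl fun l _ => ?_
      rw [hsymm k j]
      ring
    simp only [this, hR, Finset.mul_sum]
    rw [Finset.sum_comm]
    refine Finset.sum_congr rfl fun k _ => ?_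
    rw [Finset.sum_comm]
  have hy2 : ∑ j, y j ^ 2 ≤ D ^ 2 * Q := by
    calc ∑ j, y j ^ 2 = ∑ k, ∑ l, c k * c l * R k l := hyR
      _ ≤ ∑ k, ∑ l, (|c k| * |c l| * (B + 2) + if k = l then n * c k ^ 2 else 0) := by
          refine Finset.sum_le_sum fun k _ => Finset.sum_le_sum fun l _ => ?_
          refine (le_abs_self _).trans ?_
          rw [abs_mul, abs_mul]
          refine (mul_le_mul_of_nonneg_left (hRle k l) (by positivity)).trans (le_of_eq ?_)
          split_ifs with h
          · rw [← h, mul_add, mul_comm (n : ℝ), abs_mul_abs_self, sq]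
          · rw [add_zero, add_zero]
      _ = (B + 2) * (∑ k, |c k|) ^ 2 + n * Q := by
          simp only [Finset.sum_add_distrib, Finset.sum_ite_eq, Finset.mem_univ, if_true]
          rw [sq, Finset.sum_mul_sum, Finset.mul_sum, hQ, Finset.mul_sum]
          congr 1
          refine Finset.sum_congr rfl fun k _ => ?_
          rw [Finset.mul_sum]
          refine Finset.sum_congr rfl fun l _ => ?_
          ring
      _ ≤ (B + 2) * (n * Q) + n * Q := by
          have := sq_sum_le_card_mul_sum_sq (s := (Finset.univ : Finset (Fin n)))
            (f := fun k => |c k|)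
          simp only [sq_abs, Finset.card_univ, Fintype.card_fin] at this
          gcongr
      _ = n * (B + 3) * Q := by ring
      _ ≤ D ^ 2 * Q := by gcongr
  have he : ∑ j, ∑ k, M j k * c j * c k = ∑ j, c j * y j := by
    refine Finset.sum_congr rfl fun j _ => ?_
    rw [hy, Finset.mul_sum]
    refine Finset.sum_congr rfl fun k _ => ?_
    ring
  refine abs_le_of_sq_le_sq ?_ (by positivity)
  rw [he]
  calc (∑ j, c j * y j) ^ 2 ≤ Q * ∑ j, y j ^ 2 := Finset.sum_mul_sq_le_sq_mul_sq _ _ _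
    _ ≤ Q * (D ^ 2 * Q) := by gcongr
    _ = (D * Q) ^ 2 := by ring

namespace Graphon

open ProbabilityTheory

/-- The difference between the adjacency matrices of the stochastic and the weighted sample. -/
noncomputable def noise (W : Graphon) {n : ℕ} (loops : Bool) (u : Fin n → unitInterval)
    (ξ : Sym2 (Fin n) → unitInterval) (i j : Fin n) : ℝ :=
  if i = j ∧ loops = false then 0 else centredIndicator (W.toFun (u i) (u j)) (ξ s(i, j))

variable (W : Graphon) {n : ℕ} (loops : Bool)

theorem stochasticSample_adj_sub (u : Fin n → unitInterval) (ξ : Sym2 (Fin n) → unitInterval)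
    (i j : Fin n) : (W.stochasticSample loops u ξ).adj i j - (W.weightedSample loops u).adj i j =
      W.noise loops u ξ i j := by
  simp only [stochasticSample, weightedSample, noise, centredIndicator]
  split_ifs <;> simp

theorem noise_symm (u : Fin n → unitInterval) (ξ : Sym2 (Fin n) → unitInterval) (i j : Fin n) :
    W.noise loops u ξ i j = W.noise loops u ξ j i := by
  rw [← stochasticSample_adj_sub, ← stochasticSample_adj_sub, WeightedGraph.symm _ i j,
    WeightedGraph.symm (W.weightedSample loops u) i j]

theorem abs_noise_le (u : Fin n → unitInterval) (ξ : Sym2 (Fin n) → unitInterval) (i j : Fin n) :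
    |W.noise loops u ξ i j| ≤ 1 := by
  unfold noise
  split_ifs
  · simp
  · exact abs_centredIndicator_le (W.mem_Icc _ _) _

theorem measurable_noise (i j : Fin n) :
    Measurable fun ω : (Fin n → unitInterval) × (Sym2 (Fin n) → unitInterval) =>
      W.noise loops ω.1 ω.2 i j := by
  unfold noise
  split_ifs
  · exact measurable_const
  · have h1 : Measurable fun ω : (Fin n → unitInterval) × (Sym2 (Fin n) → unitInterval) =>
        W.toFun (ω.1 i) (ω.1 j) :=
      W.measurable_toFun.comp (f := fun ω :
        (Fin n → unitInterval) × (Sym2 (Fin n) → unitInterval) => (ω.1 i, ω.1 j)) (by fun_prop)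
    have h2 : Measurable fun ω : (Fin n → unitInterval) × (Sym2 (Fin n) → unitInterval) =>
        ω.2 s(i, j) := by fun_prop
    exact measurable_centredIndicator.comp (h1.prodMk h2)

theorem measurable_noise_right (u : Fin n → unitInterval) (i j : Fin n) :
    Measurable fun ξ => W.noise loops u ξ i j :=
  (W.measurable_noise loops i j).comp measurable_prodMk_left

theorem integral_noise_eq_zero (u : Fin n → unitInterval) (i j : Fin n) :
    ∫ ξ, W.noise loops u ξ i j = 0 := by
  unfold noise
  split_ifs
  · simp
  · rw [integral_eval_pi (f := centredIndicator (W.toFun (u i) (u j)))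
      (measurable_centredIndicator.comp measurable_prodMk_left)]
    exact integral_centredIndicator (W.mem_Icc _ _)

/-- The `(i, j)` entry of the square of the noise matrix, without the contributions of its
diagonal. -/
noncomputable def noiseSq (u : Fin n → unitInterval) (ξ : Sym2 (Fin n) → unitInterval)
    (i j : Fin n) : ℝ :=
  ∑ k, if k = i ∨ k = j then 0 else W.noise loops u ξ i k * W.noise loops u ξ k j

theorem measurable_noiseSq (i j : Fin n) :
    Measurable fun ω : (Fin n → unitInterval) × (Sym2 (Fin n) → unitInterval) =>
      W.noiseSq loops ω.1 ω.2 i j := by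
  refine Finset.measurable_fun_sum _ fun k _ => ?_
  split_ifs
  · exact measurable_const
  · exact (W.measurable_noise loops i k).mul (W.measurable_noise loops k j)

/-- Off the diagonal, the entries of the squared noise matrix are sums of `n` independent centred
terms, since the paths `i - k - j` through different `k` share no edge. -/
theorem hasSubgaussianMGF_noiseSq (u : Fin n → unitInterval) {i j : Fin n} (hij : i ≠ j) :
    HasSubgaussianMGF (fun ξ => W.noiseSq loops u ξ i j) (n : NNReal)
      (volume : Measure (Sym2 (Fin n) → unitInterval)) := by
  classical
  have hdep : ∀ (a b : Fin n) (ξ ξ' : Sym2 (Fin n) → unitInterval), ξ s(a, b) = ξ' s(a, b) →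
      W.noise loops u ξ a b = W.noise loops u ξ' a b := by
    intro a b ξ ξ' h
    simp only [noise, h]
  have hs := hasSubgaussianMGF_sum_of_disjoint_dependence (ι := Sym2 (Fin n))
    (X := fun k ξ => if k = i ∨ k = j then 0 else W.noise loops u ξ i k * W.noise loops u ξ k j)
    (S := fun k => if k = i ∨ k = j then ∅ else {s(i, k), s(k, j)})
    ?_ ?_ ?_ ?_ ?_ Finset.univ
  · rwa [Finset.card_univ, Fintype.card_fin] at hs
  · intro k l hkl
    split_ifs with h1 h2
    · exact Finset.disjoint_empty_left _
    · exact Finset.disjoint_empty_left _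
    · exact Finset.disjoint_empty_right _
    · rw [Finset.disjoint_left]
      intro e he he'
      simp only [Finset.mem_insert, Finset.mem_singleton] at he he'
      rcases he with rfl | rfl <;> simp only [Sym2.eq_iff] at he' <;> grind
  · intro k
    split_ifs
    · exact measurable_const
    · exact (W.measurable_noise_right loops u i k).mul (W.measurable_noise_right loops u k j)
  · intro k ξ ξ' h
    split_ifs with hk
    · rfl
    · rw [if_neg hk] at h
      rw [hdep i k ξ ξ' (h _ (by simp)), hdep k j ξ ξ' (h _ (by simp))]
  · intro k ξ
    split_ifs
    · simp
    · rw [abs_mul]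
      exact mul_le_one₀ (W.abs_noise_le _ _ _ _ _) (abs_nonneg _) (W.abs_noise_le _ _ _ _ _)
  · intro k
    split_ifs with hk
    · simp
    · have hne : s(i, k) ≠ s(k, j) := by
        simp only [ne_eq, Sym2.eq_iff]
        grind
      have hind := indepFun_of_disjoint_dependence (S := {s(i, k)}) (T := {s(k, j)})
        (by simpa using hne) (W.measurable_noise_right loops u i k)
        (W.measurable_noise_right loops u k j)
        (fun ξ ξ' h => hdep i k ξ ξ' (h _ (by simp)))
        (fun ξ ξ' h => hdep k j ξ ξ' (h _ (by simp)))
      rw [hind.integral_fun_mul_eq_mul_integral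
        (W.measurable_noise_right loops u i k).aestronglyMeasurable
        (W.measurable_noise_right loops u k j).aestronglyMeasurable,
        W.integral_noise_eq_zero, zero_mul]

theorem volume_noiseSq_le (hn : 0 < n) {b : ℝ} (hb : 0 ≤ b) {i j : Fin n} (hij : i ≠ j) :
    (volume : Measure ((Fin n → unitInterval) × (Sym2 (Fin n) → unitInterval)))
      {ω | Real.sqrt (2 * b * n * Real.log n) ≤ |W.noiseSq loops ω.1 ω.2 i j|} ≤
      2 * ENNReal.ofReal ((n : ℝ) ^ (-b)) := by
  have hm : MeasurableSet {ω : (Fin n → unitInterval) × (Sym2 (Fin n) → unitInterval) |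
      Real.sqrt (2 * b * n * Real.log n) ≤ |W.noiseSq loops ω.1 ω.2 i j|} :=
    measurableSet_le measurable_const (W.measurable_noiseSq loops i j).abs
  rw [Measure.volume_eq_prod]
  refine (Measure.prod_apply_le hm).trans ?_
  refine (lintegral_mono fun u => measure_abs_ge_le_of_hasSubgaussianMGF hn
    (W.hasSubgaussianMGF_noiseSq loops u hij) hb).trans ?_
  simp

end Graphon

/-! ### Eigenvalues of sampled graphs -/

namespace Graphon

/-- The weighted sample has the eigenvalues of its relabelling along the sorted sample points, which
is close to `W` in Hilbert–Schmidt norm. -/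
theorem abs_eigenvalue_weightedSample_sub_le {W : Graphon} {K : ℕ} {L : ℝ}
    (hW : W.IsPiecewiseLipschitz K L) {n : ℕ} (hn : 0 < n) (loops : Bool)
    (u : Fin n → unitInterval) {η δ : ℝ} (hη : 0 ≤ η) (hδ : 0 ≤ δ)
    (hcount : ∀ k : ℕ, k ≤ n → |(sampleCount u (k / n) : ℝ) - k| ≤ η)
    (h : 4 * L ^ 2 * ((η + 2) / n) ^ 2 + 4 * (K + 1) * ((η + 2) / n) + 1 / n ≤ δ ^ 2)
    {i : ℤ} (hi : i ≠ 0) :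
    |(W.weightedSample loops u).inducedGraphon.eigenvalue i - W.eigenvalue i| ≤ δ := by
  set σ := Tuple.sort u
  have hperm : (W.weightedSample loops (u ∘ σ)).inducedGraphon.eigenvalue i =
      (W.weightedSample loops u).inducedGraphon.eigenvalue i :=
    WeightedGraph.eigenvalue_inducedGraphon_perm _ _ σ
      (fun j k => by simp [weightedSample]) hi
  rw [← hperm]
  refine abs_eigenvalue_sub_le _ _ (WeightedGraph.isCompactOperator_inducedGraphon _)
    (isCompactOperator_of_isPiecewiseLipschitz hW) hδ ?_ hi
  refine norm_operator_sub_le _ _ hδ (le_trans ?_ h)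
  exact integral_sq_weightedSample_sub_le hW hn loops (u ∘ σ) (by positivity)
    fun j x hx => abs_sort_sub_le u hη hcount j hx

theorem abs_eigenvalue_stochasticSample_sub_le (W : Graphon) {n : ℕ} (hn : 0 < n) (loops : Bool)
    (u : Fin n → unitInterval) (ξ : Sym2 (Fin n) → unitInterval) {η δ : ℝ} (hη : 0 ≤ η)
    (hδ : 0 ≤ δ) (hnoise : ∀ i j, i ≠ j → |W.noiseSq loops u ξ i j| ≤ η)
    (h : (η + 3) / n ≤ δ ^ 2) {i : ℤ} (hi : i ≠ 0) :
    |(W.stochasticSample loops u ξ).inducedGraphon.eigenvalue i -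
      (W.weightedSample loops u).inducedGraphon.eigenvalue i| ≤ δ := by
  have hn' : (0 : ℝ) < n := by exact_mod_cast hn
  refine WeightedGraph.abs_eigenvalue_inducedGraphon_sub_le _ _ hδ (fun c => ?_) hi
  simp only [stochasticSample_adj_sub]
  refine abs_quadratic_form_le (W.noise_symm loops u ξ) (W.abs_noise_le loops u ξ)
    (by positivity) hnoise hη ?_ c
  rw [div_le_iff₀ hn'] at h
  calc (n : ℝ) * (η + 3) ≤ n * (δ ^ 2 * n) := by gcongr
    _ = (n * δ) ^ 2 := by ring

/-- A bound for the failure probability of the count bounds at all grid points `k / n`. -/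
theorem volume_exists_sampleCount_le {n : ℕ} (hn : 0 < n) {b : ℝ} (hb : 0 ≤ b) :
    (volume : Measure (Fin n → unitInterval))
      {u | ∃ k : ℕ, k ≤ n ∧
        Real.sqrt (2 * b * n * Real.log n) ≤ |(sampleCount u (k / n) : ℝ) - k|} ≤
      (n + 1 : ℕ) * (2 * ENNReal.ofReal ((n : ℝ) ^ (-b))) := by
  refine (measure_mono (t := ⋃ k ∈ Finset.range (n + 1), {u : Fin n → unitInterval |
    Real.sqrt (2 * b * n * Real.log n) ≤ |(sampleCount u (k / n) : ℝ) - k|}) ?_).trans ?_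
  · rintro u ⟨k, hk, hu⟩
    exact Set.mem_biUnion (Finset.mem_coe.2 (Finset.mem_range.2 (Nat.lt_succ_of_le hk))) hu
  · refine (measure_biUnion_finset_le _ _).trans ?_
    refine (Finset.sum_le_sum fun k hk =>
      volume_sampleCount_le hn (Nat.lt_succ_iff.1 (Finset.mem_range.1 hk)) hb).trans ?_
    simp

/-- A bound for the failure probability of the estimates of all off-diagonal entries of the squared
noise. -/
theorem volume_exists_noiseSq_le (W : Graphon) (loops : Bool) {n : ℕ} (hn : 0 < n) {b : ℝ}
    (hb : 0 ≤ b) :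
    (volume : Measure ((Fin n → unitInterval) × (Sym2 (Fin n) → unitInterval)))
      {ω | ∃ i j, i ≠ j ∧
        Real.sqrt (2 * b * n * Real.log n) ≤ |W.noiseSq loops ω.1 ω.2 i j|} ≤
      (n * n : ℕ) * (2 * ENNReal.ofReal ((n : ℝ) ^ (-b))) := by
  classical
  refine (measure_mono (t := ⋃ p ∈ Finset.univ.filter fun p : Fin n × Fin n => p.1 ≠ p.2,
    {ω : (Fin n → unitInterval) × (Sym2 (Fin n) → unitInterval) |
      Real.sqrt (2 * b * n * Real.log n) ≤ |W.noiseSq loops ω.1 ω.2 p.1 p.2|}) ?_).trans ?_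
  · rintro ω ⟨i, j, hij, hω⟩
    exact Set.mem_biUnion (x := (i, j)) (by simpa using hij) hω
  · refine (measure_biUnion_finset_le _ _).trans ?_
    refine (Finset.sum_le_sum fun p hp =>
      W.volume_noiseSq_le loops hn hb (Finset.mem_filter.1 hp).2).trans ?_
    rw [Finset.sum_const, nsmul_eq_mul]
    gcongr
    exact_mod_cast (Finset.card_filter_le _ _).trans (by simp)

end Graphon

/-- A union bound over at most `n ^ 3 / 2` events of probability `2 n ^ (-(a + 4))`. -/
theorem natCast_mul_two_mul_ofReal_rpow_le {n m : ℕ} (hn : 2 ≤ n) (hm : 2 * m ≤ n ^ 3) (a : ℝ) :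
    (m : ENNReal) * (2 * ENNReal.ofReal ((n : ℝ) ^ (-(a + 4)))) ≤
      ENNReal.ofReal ((n : ℝ) ^ (-a) / 2) := by
  have hn' : (0 : ℝ) < n := by exact_mod_cast (by omega : 0 < n)
  have e : (m : ENNReal) * (2 * ENNReal.ofReal ((n : ℝ) ^ (-(a + 4)))) =
      ENNReal.ofReal ((2 * m : ℕ) * (n : ℝ) ^ (-(a + 4))) := by
    rw [ENNReal.ofReal_mul (by positivity), ENNReal.ofReal_natCast]
    push_cast
    ring
  rw [e]
  refine ENNReal.ofReal_le_ofReal ?_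
  have h1 : ((2 * m : ℕ) : ℝ) ≤ (n : ℝ) ^ 3 := by exact_mod_cast hm
  have h2 : (n : ℝ) ^ (-(a + 4)) * n ^ 4 = (n : ℝ) ^ (-a) := by
    rw [← Real.rpow_natCast, ← Real.rpow_add hn']
    norm_num
  have h3 : (2 : ℝ) ≤ n := by exact_mod_cast hn
  have h4 : 0 < (n : ℝ) ^ (-(a + 4)) := by positivity
  rw [le_div_iff₀ two_pos, ← h2]
  calc ((2 * m : ℕ) : ℝ) * (n : ℝ) ^ (-(a + 4)) * 2
      ≤ (n : ℝ) ^ 3 * (n : ℝ) ^ (-(a + 4)) * n := by gcongr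
    _ = (n : ℝ) ^ (-(a + 4)) * n ^ 4 := by ring

/-- With `s = √(log n / n)`, the deviation `√(2 b n log n)` of the counts and all multiples of
`1 / n` are of order `n s`. -/
theorem sqrt_deviation_bounds {n : ℕ} (hn : 2 ≤ n) {b : ℝ} (hb : 0 ≤ b) :
    1 / (n : ℝ) ≤ 2 * Real.sqrt (Real.log n / n) ∧ Real.sqrt (Real.log n / n) ≤ 1 ∧
      (Real.sqrt (2 * b * n * Real.log n) + 3) / n ≤
        (Real.sqrt (2 * b) + 6) * Real.sqrt (Real.log n / n) := by
  have hn2 : (2 : ℝ) ≤ n := by exact_mod_cast hn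
  have hn' : (0 : ℝ) < n := by linarith
  set q := Real.log n / n with hq
  have hlog : 1 / 2 ≤ Real.log n := by
    have := Real.log_two_gt_d9
    have := Real.log_le_log two_pos hn2
    linarith
  have hq0 : 0 ≤ q := by positivity
  have hq1 : q ≤ 1 := by
    rw [hq, div_le_one hn']
    linarith [Real.log_le_sub_one_of_pos hn']
  have hqs : q ≤ Real.sqrt q := Real.le_sqrt_of_sq_le (by nlinarith)
  have h1 : 1 / (n : ℝ) ≤ 2 * q := by
    rw [hq, ← mul_div_assoc]
    gcongr
    linarith
  have h2 : 1 / (n : ℝ) ≤ 2 * Real.sqrt q := by linarith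
  refine ⟨h2, Real.sqrt_le_one.2 hq1, ?_⟩
  have e : Real.sqrt (2 * b * n * Real.log n) = n * (Real.sqrt (2 * b) * Real.sqrt q) := by
    rw [← Real.sqrt_mul (by positivity), ← Real.sqrt_sq hn'.le, ← Real.sqrt_mul (by positivity),
      Real.sqrt_sq hn'.le]
    congr 1
    rw [hq]
    field_simp
  rw [e, add_div, mul_div_cancel_left₀ _ hn'.ne']
  have h3 : 3 / (n : ℝ) = 3 * (1 / n) := by ring
  rw [h3]
  linarith

theorem mainTheorem3 (K : ℕ) (L : ℝ) (a : ℝ) (ha : 0 < a) :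
    ∃ C : ℝ, ∀ W : Graphon, W.IsPiecewiseLipschitz K L →
      ∀ n : ℕ, 2 ≤ n → ∀ loops : Bool,
        (volume : Measure (Fin n → unitInterval))
          {u | ¬ ∀ i : ℤ, i ≠ 0 →
            |(W.weightedSample loops u).inducedGraphon.eigenvalue i - W.eigenvalue i| ≤
              C * (Real.log n / n) ^ (1 / 4 : ℝ)} ≤ ENNReal.ofReal ((n : ℝ) ^ (-a)) ∧
        (volume : Measure ((Fin n → unitInterval) × (Sym2 (Fin n) → unitInterval)))
          {ω | ¬ ∀ i : ℤ, i ≠ 0 →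
            |(W.stochasticSample loops ω.1 ω.2).inducedGraphon.eigenvalue i - W.eigenvalue i| ≤
              C * (Real.log n / n) ^ (1 / 4 : ℝ)} ≤ ENNReal.ofReal ((n : ℝ) ^ (-a)) := by
  have hb : 0 ≤ a + 4 := by linarith
  set ρ : ℝ := Real.sqrt (2 * (a + 4)) + 6 with hρ
  have hρ0 : 0 ≤ ρ := by positivity
  set c₁ : ℝ := 4 * L ^ 2 * ρ ^ 2 + 4 * (K + 1) * ρ + 2 with hc₁
  have hc₁0 : 0 ≤ c₁ := by positivity
  refine ⟨Real.sqrt c₁ + Real.sqrt ρ, fun W hW n hn loops => ?_⟩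
  have hn0 : 0 < n := by omega
  have hn' : (0 : ℝ) < n := by exact_mod_cast hn0
  obtain ⟨h1n, hs1, hdev⟩ := sqrt_deviation_bounds hn hb
  rw [← hρ] at hdev
  set η := Real.sqrt (2 * (a + 4) * n * Real.log n) with hη
  have hη0 : 0 ≤ η := Real.sqrt_nonneg _
  set s := Real.sqrt (Real.log n / n) with hs
  have hs0 : 0 ≤ s := Real.sqrt_nonneg _
  set T := (Real.log n / n) ^ (1 / 4 : ℝ) with hT
  have hq0 : 0 ≤ Real.log n / n := div_nonneg (Real.log_natCast_nonneg n) hn'.le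
  have hT0 : 0 ≤ T := Real.rpow_nonneg hq0 _
  have hT2 : T ^ 2 = s := by
    rw [hT, hs, Real.sqrt_eq_rpow, ← Real.rpow_natCast, ← Real.rpow_mul hq0]
    norm_num
  have hr : (η + 2) / n ≤ ρ * s := by
    refine le_trans ?_ hdev
    gcongr
    norm_num
  have hδ₁ : 4 * L ^ 2 * ((η + 2) / n) ^ 2 + 4 * (K + 1) * ((η + 2) / n) + 1 / n ≤
      (Real.sqrt c₁ * T) ^ 2 := by
    rw [mul_pow, Real.sq_sqrt hc₁0, hT2]
    calc 4 * L ^ 2 * ((η + 2) / n) ^ 2 + 4 * (K + 1) * ((η + 2) / n) + 1 / n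
        ≤ 4 * L ^ 2 * (ρ * s) ^ 2 + 4 * (K + 1) * (ρ * s) + 2 * s := by gcongr
      _ = 4 * L ^ 2 * ρ ^ 2 * (s * s) + 4 * (K + 1) * ρ * s + 2 * s := by ring
      _ ≤ 4 * L ^ 2 * ρ ^ 2 * (s * 1) + 4 * (K + 1) * ρ * s + 2 * s := by gcongr
      _ = c₁ * s := by rw [hc₁]; ring
  have hδ₂ : (η + 3) / n ≤ (Real.sqrt ρ * T) ^ 2 := by
    rw [mul_pow, Real.sq_sqrt hρ0, hT2]
    exact hdev
  set E : Set (Fin n → unitInterval) :=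
    {u | ∃ k : ℕ, k ≤ n ∧ η ≤ |(sampleCount u (k / n) : ℝ) - k|} with hE
  have hEv : volume E ≤ ENNReal.ofReal ((n : ℝ) ^ (-a) / 2) :=
    (Graphon.volume_exists_sampleCount_le hn0 hb).trans
      (natCast_mul_two_mul_ofReal_rpow_le hn
        (by nlinarith [Nat.mul_le_mul_right n (Nat.mul_le_mul hn hn)]) a)
  have hweighted : ∀ u ∉ E, ∀ i : ℤ, i ≠ 0 →
      |(W.weightedSample loops u).inducedGraphon.eigenvalue i - W.eigenvalue i| ≤
        Real.sqrt c₁ * T := by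
    intro u hu i hi
    refine Graphon.abs_eigenvalue_weightedSample_sub_le hW hn0 loops u hη0 (by positivity)
      (fun k hk => ?_) hδ₁ hi
    by_contra! hlt
    exact hu ⟨k, hk, hlt.le⟩
  constructor
  · refine (measure_mono (t := E) fun u hu => ?_).trans (hEv.trans ?_)
    · by_contra hE'
      refine hu fun i hi => (hweighted u hE' i hi).trans ?_
      rw [add_mul]
      exact le_add_of_nonneg_right (by positivity)
    · refine ENNReal.ofReal_le_ofReal (half_le_self (by positivity))
  · set F : Set ((Fin n → unitInterval) × (Sym2 (Fin n) → unitInterval)) :=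
      {ω | ∃ i j, i ≠ j ∧ η ≤ |W.noiseSq loops ω.1 ω.2 i j|} with hF
    have hFv : volume F ≤ ENNReal.ofReal ((n : ℝ) ^ (-a) / 2) :=
      (W.volume_exists_noiseSq_le loops hn0 hb).trans
        (natCast_mul_two_mul_ofReal_rpow_le hn (by nlinarith) a)
    have hEv' : (volume : Measure ((Fin n → unitInterval) × (Sym2 (Fin n) → unitInterval)))
        (E ×ˢ Set.univ) ≤ ENNReal.ofReal ((n : ℝ) ^ (-a) / 2) := by
      rw [Measure.volume_eq_prod, Measure.prod_prod, measure_univ, mul_one]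
      exact hEv
    refine (measure_mono (t := E ×ˢ Set.univ ∪ F) fun ω hω => ?_).trans
      ((measure_union_le _ _).trans ((add_le_add hEv' hFv).trans ?_))
    · by_contra hEF
      rw [Set.mem_union, not_or] at hEF
      refine hω fun i hi => ?_
      have h1 := hweighted ω.1 (fun h => hEF.1 ⟨h, trivial⟩) i hi
      have h2 := W.abs_eigenvalue_stochasticSample_sub_le hn0 loops ω.1 ω.2 hη0
        (by positivity) (fun j k hjk => by
          by_contra! hlt
          exact hEF.2 ⟨j, k, hjk, hlt.le⟩) hδ₂ hi
      refine (abs_sub_le _ ((W.weightedSample loops ω.1).inducedGraphon.eigenvalue i) _).trans ?_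
      rw [add_mul, add_comm]
      exact add_le_add h1 h2
    · rw [← ENNReal.ofReal_add (by positivity) (by positivity), add_halves]
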